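/- Let $m,n\in\mathbb N$ with $1\le m<n$, and let $\varrho$ be a rearrangement-invariant norm on $\mathcal M_+(\mathbb R^n)$, the nonnegative Lebesgue measurable functions with values in $[0,\infty]$. That is, for all $f,g,f_j\in\mathcal M_+(\mathbb R^n)$, $\lambda\ge 0$ and $E\subseteq\mathbb R^n$ measurable with $|E|<\infty$: - $\varrho(f)=0$ iff $f=0$ a.e.; $\varrho(\lambda f)=\lambda\varrho(f)$; $\varrho(f+g)\le\varrho(f)+\varrho(g)$; - $f\le g$ a.e. implies $\varrho(f)\le\varrho(g)$; and $f_j\nearrow f$ a.e. implies $\varrho(f_j)\nearrow\varrho(f)$; - $\varrho(\chi_E)<\infty$, and $\int_E f\le C_E\,\varrho(f)$ with $C_E<\infty$ independent of $f$; - $\varrho(f)=\varrho(g)$ whenever $f^*=g^*$ on $(0,\infty)$, where $f^*(t)=\inf\{\lambda>0:|\{|f|>\lambda\}|\le t\}$ for $t>0$. Let $Y$ be the rearrangement-invariant space given by $\varrho$, and let $Y'$ be its associate space, given by $\varrho'(g)=\sup\{\int_{\mathbb R^n} fg : f\in\mathcal M_+(\mathbb R^n),\ \varrho(f)\le 1\}$.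 Let $Y(0,\infty)$ and $Y'(0,\infty)$ be the representation spaces of $Y$ and $Y'$, i.e. the rearrangement-invariant spaces over $(0,\infty)$ determined by $\|f\|_{Y}=\|f^*\|_{Y(0,\infty)}$ and $\|f\|_{Y'}=\|f^*\|_{Y'(0,\infty)}$ for all measurable $f$ on $\mathbb R^n$. Let $\varphi_Y(t)=\varrho(\chi_E)$, where $|E|=t$, be the fundamental function of $Y$. Write $h\sim f$ if $h^*=f^*$ on $(0,\infty)$. Put $$T_{m/n}f(t)=t^{-m/n}\sup_{t\le s<\infty}s^{m/n}f^*(s)\qquad (t>0)$$ for measurable $f$ on $(0,\infty)$ and, for $f\in\mathcal M_+(\mathbb R^n)$, $$\tau_m(f)=\sup_{\substack{h\sim f\\ h\in\mathcal M_+(0,\infty)}}\Big\|\int_t^\infty h(s)s^{\frac mn-1}\,ds\Big\|_{Y(0,\infty)},\qquad \nu_m(f)=\Big\|\int_t^\infty f^*(s)s^{\frac mn-1}\,ds\Big\|_{Y(0,\infty)}.$$ Call $\tau_m$ and $\nu_m$ equivalent if there is a constant $0<C<\infty$ with $C^{-1}\nu_m(f)\le\tau_m(f)\le C\nu_m(f)$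 for all $f\in\mathcal M_+(\mathbb R^n)$. **Theorem 3.6.** If $T_{m/n}$ is bounded on $Y'(0,\infty)$, i.e. $\|T_{m/n}f\|_{Y'(0,\infty)}\le C\|f\|_{Y'(0,\infty)}$ for all $f$ with a finite constant $C$, then $$\inf_{1\le t<\infty}\frac{t^{1-\frac mn}}{\varphi_Y(t)}>0$$ and $\tau_m$ is equivalent to $\nu_m$. Conversely, if $T_{m/n}$ is not bounded on $Y'(0,\infty)$, then $\tau_m$ is not equivalent to $\nu_m$. -/

import Mathlib

open MeasureTheory Set
open scoped ENNReal NNReal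

/-- Lebesgue measure on the half-line `(0, ∞)`. Functions on `(0, ∞)` are represented by functions
on `ℝ`, whose values outside `(0, ∞)` are irrelevant. -/
noncomputable abbrev halfLine : Measure ℝ := volume.restrict (Ioi 0)

/-- The nonincreasing rearrangement `f^*(t) = inf {s : μ {f > s} ≤ t}` of a nonnegative function.
(Whether `s` ranges over `(0, ∞)` or over `[0, ∞]` does not affect the infimum.) -/
noncomputable def rearr {α : Type*} [MeasurableSpace α] (μ : Measure α) (f : α → ℝ≥0∞) (t : ℝ) :
    ℝ≥0∞ :=
  sInf {s : ℝ≥0∞ | μ {x | s < f x} ≤ ENNReal.ofReal t}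

/-- Functions on possibly different measure spaces are equimeasurable if their nonincreasing
rearrangements agree on `(0, ∞)`. -/
def Equimeasurable {α β : Type*} [MeasurableSpace α] [MeasurableSpace β]
    (μ : Measure α) (ν : Measure β) (f : α → ℝ≥0∞) (g : β → ℝ≥0∞) : Prop :=
  ∀ t : ℝ, 0 < t → rearr μ f t = rearr ν g t

/-- Rearrangement-invariant (Banach function) norms. The class of nonnegative `μ`-measurable
functions consists of the `AEMeasurable` functions with values in `[0, ∞]`; the values of `ρ` at
other functions are irrelevant. -/
structure IsRearrangementInvariantNorm {α : Type*} [MeasurableSpace α] (μ : Measure α)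
    (ρ : (α → ℝ≥0∞) → ℝ≥0∞) : Prop where
  eq_zero_iff : ∀ f : α → ℝ≥0∞, AEMeasurable f μ → (ρ f = 0 ↔ f =ᵐ[μ] 0)
  smul : ∀ (c : ℝ≥0) (f : α → ℝ≥0∞), AEMeasurable f μ → ρ (fun x => c * f x) = c * ρ f
  add_le : ∀ f g : α → ℝ≥0∞, AEMeasurable f μ → AEMeasurable g μ →
    ρ (fun x => f x + g x) ≤ ρ f + ρ g
  mono : ∀ f g : α → ℝ≥0∞, AEMeasurable f μ → AEMeasurable g μ → f ≤ᵐ[μ] g → ρ f ≤ ρ g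
  fatou : ∀ (f : ℕ → α → ℝ≥0∞) (g : α → ℝ≥0∞), (∀ j, AEMeasurable (f j) μ) → AEMeasurable g μ →
    (∀ᵐ x ∂μ, Monotone (fun j => f j x) ∧ ⨆ j, f j x = g x) → ⨆ j, ρ (f j) = ρ g
  indicator_lt_top : ∀ E : Set α, NullMeasurableSet E μ → μ E < ∞ → ρ (E.indicator 1) < ∞
  local_embedding : ∀ E : Set α, NullMeasurableSet E μ → μ E < ∞ →
    ∃ C : ℝ≥0, ∀ f : α → ℝ≥0∞, AEMeasurable f μ → ∫⁻ x in E, f x ∂μ ≤ C * ρ f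
  rearrangement_invariant : ∀ f g : α → ℝ≥0∞, AEMeasurable f μ → AEMeasurable g μ →
    Equimeasurable μ μ f g → ρ f = ρ g

/-- The associate norm `ρ'(g) = sup {∫ f g dμ : f ≥ 0, ρ(f) ≤ 1}`. -/
noncomputable def assocNorm {α : Type*} [MeasurableSpace α] (μ : Measure α)
    (ρ : (α → ℝ≥0∞) → ℝ≥0∞) (g : α → ℝ≥0∞) : ℝ≥0∞ :=
  ⨆ (f : α → ℝ≥0∞) (_ : AEMeasurable f μ) (_ : ρ f ≤ 1), ∫⁻ x, f x * g x ∂μ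

/-- The fundamental function `φ(t) = ρ(χ_E)`, where `E` is any measurable set with `μ E = t`
(for a rearrangement-invariant `ρ` the value does not depend on the choice of `E`). -/
noncomputable def fundamentalFunction {α : Type*} [MeasurableSpace α] (μ : Measure α)
    (ρ : (α → ℝ≥0∞) → ℝ≥0∞) (t : ℝ) : ℝ≥0∞ :=
  ⨆ (E : Set α) (_ : MeasurableSet E) (_ : μ E = ENNReal.ofReal t), ρ (E.indicator 1)

/-- The norm of the representation space over `(0, ∞)` of the rearrangement-invariant space over
`ℝⁿ` given by `ρ`. It sends `F` to the `ρ`-norm of the radial function `x ↦ F^*(|B(0, |x|)|)`, which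
is equimeasurable with `F`; so it is the only rearrangement-invariant functional on `(0, ∞)` whose
value at `f^*` is `ρ f` for all nonnegative measurable `f` on `ℝⁿ`. -/
noncomputable def reprNorm {n : ℕ} (ρ : (EuclideanSpace ℝ (Fin n) → ℝ≥0∞) → ℝ≥0∞)
    (F : ℝ → ℝ≥0∞) : ℝ≥0∞ :=
  ρ (fun x => rearr halfLine F (volume (Metric.ball (0 : EuclideanSpace ℝ (Fin n)) ‖x‖)).toReal)

/-- The operator `T_a f(t) = t^{-a} sup_{t ≤ s < ∞} s^a f^*(s)`. -/
noncomputable def supOp (a : ℝ) (f : ℝ → ℝ≥0∞) (t : ℝ) : ℝ≥0∞ :=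
  ENNReal.ofReal (t ^ (-a)) * ⨆ (s : ℝ) (_ : t ≤ s), ENNReal.ofReal (s ^ a) * rearr halfLine f s

/-- The weighted Hardy operator `h ↦ ∫_t^∞ h(s) s^{a - 1} ds`. -/
noncomputable def hardyOp (a : ℝ) (h : ℝ → ℝ≥0∞) (t : ℝ) : ℝ≥0∞ :=
  ∫⁻ s in Ioi t, h s * ENNReal.ofReal (s ^ (a - 1))

/-- Boundedness of an operator with respect to a functional `N` on the nonnegative measurable
functions on `(0, ∞)`. -/
def BoundedOn (N : (ℝ → ℝ≥0∞) → ℝ≥0∞) (T : (ℝ → ℝ≥0∞) → ℝ → ℝ≥0∞) : Prop :=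
  ∃ C : ℝ≥0, ∀ f : ℝ → ℝ≥0∞, AEMeasurable f halfLine → N (T f) ≤ C * N f

/-- The functional `τ_m(f)`: the supremum of `‖∫_t^∞ h(s) s^{m/n - 1} ds‖_{Y(0, ∞)}` over all
nonnegative measurable `h` on `(0, ∞)` equimeasurable with `f`. -/
noncomputable def tauNorm {n : ℕ} (m : ℕ) (ρ : (EuclideanSpace ℝ (Fin n) → ℝ≥0∞) → ℝ≥0∞)
    (f : EuclideanSpace ℝ (Fin n) → ℝ≥0∞) : ℝ≥0∞ :=
  ⨆ (h : ℝ → ℝ≥0∞) (_ : AEMeasurable h halfLine) (_ : Equimeasurable halfLine volume h f),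
    reprNorm ρ (hardyOp ((m : ℝ) / n) h)

/-- The functional `f ↦ ‖∫_t^∞ f^*(s) s^{m/n - 1} ds‖_{Y(0, ∞)}`. -/
noncomputable def starNorm {n : ℕ} (m : ℕ) (ρ : (EuclideanSpace ℝ (Fin n) → ℝ≥0∞) → ℝ≥0∞)
    (f : EuclideanSpace ℝ (Fin n) → ℝ≥0∞) : ℝ≥0∞ :=
  reprNorm ρ (hardyOp ((m : ℝ) / n) (rearr volume f))

/-- Two functionals on the nonnegative `μ`-measurable functions are equivalent if each is bounded
by a constant multiple of the other. -/
def EquivalentFunctionals {α : Type*} [MeasurableSpace α] (μ : Measure α)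
    (σ τ : (α → ℝ≥0∞) → ℝ≥0∞) : Prop :=
  ∃ C : ℝ≥0, 0 < C ∧ ∀ f : α → ℝ≥0∞, AEMeasurable f μ → σ f ≤ C * τ f ∧ τ f ≤ C * σ f

/-!
The map `ballVolume`, sending `x` to the volume of the ball with center `0` and radius `‖x‖`,
carries Lebesgue measure on `ℝⁿ` to Lebesgue measure on `(0, ∞)`. Hence
`σ F = ρ (F ∘ ballVolume)` is a rearrangement-invariant norm on the half-line. The representation
norm of the space is `σ`, and that of the associate space is `g ↦ σ' (g^*)`, by the Hardy–Littlewood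
inequality (`lintegral_mul_comp_le_rearr`). Everything else takes place on the half-line, with
`a = m / n`, the Hardy operator `H = hardyOp a` and the supremum operator `T = supOp a`.

By Tonelli, `∫ G · H h = ∫ h w` for `w(s) = s^{a - 1} ∫_0^s G`. Let `G` be nonincreasing. The link
between the two operators is that the least nonincreasing majorant `W` of `w` is comparable with
`s^{a - 1} ∫_0^s T G` (`decMajorant_headIntegral_le` and `headIntegral_le_decMajorant`), so that
`∫ h^* W` is comparable with `∫ T G · H h^*`.

* Suppose that `T` is bounded on the associate space. The norm of the nonincreasing function `H h`
  is the supremum of `∫ G · H h` over nonincreasing `G` with `σ' G ≤ 1`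
  (`IsRearrangementInvariantNorm.exists_antitoneOn_dual`). Moreover
  `∫ G · H h = ∫ h w ≤ ∫ h^* W ≲ ∫ T G · H h^*`, and Hölder's inequality gives
  `σ (H h) ≲ σ (H h^*)`. The duality statement comes from the finite-dimensional Hahn–Banach theorem
  for step functions on a grid and from the fact that averaging nonincreasing functions over the
  cells of a grid does not increase the norm (`IsRearrangementInvariantNorm.cellAvg_le`).

* Conversely, suppose that `σ (H h) ≲ σ (H h^*)` for all `h`. As `w` is doubling, moving the dyadic
  blocks of a nonincreasing `k` to blocks where `w` nearly attains its supremum gives a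
  rearrangement `h` of `k` with `∫ k W ≲ ∫ h w = ∫ G · H h`
  (`exists_equimeasurable_lintegral_le`). Hence
  `∫ T G · H k ≲ ∫ k W ≲ σ' (G) σ (H h) ≲ σ' (G) σ (H k)`. Every nonincreasing `q` of finite support
  has a companion `k` such that `H k ≲ q` and `∫ T G · q ≲ ∫ T G · H k`: replace
  `χ_{(0, r)}` by `r^{-a} χ_{(0, r)}` in the layer cake decomposition of `q` (`hardyPreimage`).
  Therefore `T` is bounded.

The lower bound on `t^{1 - a} / φ(t)` follows by applying `T` to the indicator function of `(0, t)`: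
the result is at least `t^a` on `(0, 1 / 2)`, and `σ' χ_{(0, t)} ≤ t / φ(t)` by averaging.
-/

/-! ### Nonincreasing rearrangements -/

section Rearrangement

variable {α β : Type*} [MeasurableSpace α] [MeasurableSpace β] {μ : Measure α} {ν : Measure β}

/-- The infimum defining `rearr` is attained, since the distribution function is
right-continuous. All other facts on rearrangements are read off from this equivalence. -/
theorem rearr_le_iff {f : α → ℝ≥0∞} {t : ℝ} {s : ℝ≥0∞} :
    rearr μ f t ≤ s ↔ μ {x | s < f x} ≤ ENNReal.ofReal t := by
  refine ⟨fun h => ?_, fun h => sInf_le h⟩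
  rcases eq_or_ne s ∞ with rfl | hs
  · simp
  obtain ⟨u, hu, hus, hlim⟩ := exists_seq_strictAnti_tendsto' (lt_top_iff_ne_top.2 hs)
  have hU : {x | s < f x} = ⋃ n, {x | u n < f x} := by
    ext x
    simp only [mem_ofPred_eq, mem_iUnion]
    refine ⟨fun hx => ?_, fun ⟨n, hn⟩ => (hus n).1.trans hn⟩
    exact ((hlim.eventually_lt_const hx).exists)
  have hmono : Monotone fun n => {x | u n < f x} := fun i j hij x hx =>
    lt_of_le_of_lt (hu.antitone hij) hx
  rw [hU, hmono.measure_iUnion]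
  refine iSup_le fun n => ?_
  obtain ⟨s', hs', hlt⟩ := sInf_lt_iff.1 (lt_of_le_of_lt h (hus n).1)
  exact (measure_mono fun x hx => lt_trans hlt hx).trans hs'

theorem lt_rearr_iff {f : α → ℝ≥0∞} {t : ℝ} {s : ℝ≥0∞} :
    s < rearr μ f t ↔ ENNReal.ofReal t < μ {x | s < f x} := by
  rw [← not_le, rearr_le_iff, not_le]

theorem rearr_antitone (f : α → ℝ≥0∞) : Antitone (rearr μ f) := fun _ _ h =>
  rearr_le_iff.2 ((rearr_le_iff.1 le_rfl).trans (ENNReal.ofReal_le_ofReal h))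

theorem halfLine_setOf_ofReal_lt (c : ℝ≥0∞) : halfLine {t | ENNReal.ofReal t < c} = c := by
  have hm : MeasurableSet {t : ℝ | ENNReal.ofReal t < c} :=
    measurableSet_lt ENNReal.measurable_ofReal measurable_const
  rw [Measure.restrict_apply hm]
  rcases eq_or_ne c ∞ with rfl | hc
  · simp
  · have : {t : ℝ | ENNReal.ofReal t < c} ∩ Ioi 0 = Ioo 0 c.toReal := by
      ext t
      simp only [mem_inter_iff, mem_ofPred_eq, mem_Ioi, mem_Ioo]
      rw [and_comm]
      refine and_congr_right fun ht => ?_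
      rw [ENNReal.ofReal_lt_iff_lt_toReal ht.le hc]
    rw [this, Real.volume_Ioo, sub_zero, ENNReal.ofReal_toReal hc]

/-- The rearrangement has the same distribution function as the original function. -/
theorem halfLine_lt_rearr (f : α → ℝ≥0∞) (s : ℝ≥0∞) :
    halfLine {t | s < rearr μ f t} = μ {x | s < f x} := by
  simp only [lt_rearr_iff]
  exact halfLine_setOf_ofReal_lt _

theorem equimeasurable_iff {f : α → ℝ≥0∞} {g : β → ℝ≥0∞} :
    Equimeasurable μ ν f g ↔ ∀ s, μ {x | s < f x} = ν {x | s < g x} := by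
  refine ⟨fun h s => ?_, fun h t _ => ?_⟩
  · rw [← halfLine_lt_rearr f, ← halfLine_lt_rearr g]
    rw [Measure.restrict_apply' measurableSet_Ioi, Measure.restrict_apply' measurableSet_Ioi]
    congr 1
    ext t
    simp only [mem_inter_iff, mem_ofPred_eq, mem_Ioi]
    refine and_congr_left fun ht => ?_
    rw [h t ht]
  · simp only [rearr, h]

theorem Equimeasurable.symm {f : α → ℝ≥0∞} {g : β → ℝ≥0∞} (h : Equimeasurable μ ν f g) :
    Equimeasurable ν μ g f := fun t ht => (h t ht).symm

theorem Equimeasurable.trans {γ : Type*} [MeasurableSpace γ] {π : Measure γ} {f : α → ℝ≥0∞}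
    {g : β → ℝ≥0∞} {k : γ → ℝ≥0∞} (h : Equimeasurable μ ν f g) (h' : Equimeasurable ν π g k) :
    Equimeasurable μ π f k := fun t ht => (h t ht).trans (h' t ht)

theorem Equimeasurable.rearr_eq {f : α → ℝ≥0∞} {g : β → ℝ≥0∞} (h : Equimeasurable μ ν f g) :
    rearr μ f = rearr ν g := by
  funext t
  simp only [rearr, equimeasurable_iff.1 h]

theorem equimeasurable_rearr (f : α → ℝ≥0∞) : Equimeasurable halfLine μ (rearr μ f) f :=
  equimeasurable_iff.2 (halfLine_lt_rearr f)

theorem MeasureTheory.MeasurePreserving.equimeasurable_comp {V : α → β}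
    (hV : MeasurePreserving V μ ν) {F : β → ℝ≥0∞} (hF : AEMeasurable F ν) :
    Equimeasurable μ ν (F ∘ V) F :=
  equimeasurable_iff.2 fun _ =>
    hV.measure_preimage (hF.nullMeasurableSet_preimage measurableSet_Ioi)

theorem rearr_le_self_of_antitoneOn {F : ℝ → ℝ≥0∞} (hF : AntitoneOn F (Ioi 0)) {t : ℝ}
    (ht : 0 < t) : rearr halfLine F t ≤ F t := by
  rw [rearr_le_iff, Measure.restrict_apply' measurableSet_Ioi]
  have : {x | F t < F x} ∩ Ioi 0 ⊆ Ioo 0 t := fun x hx =>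
    ⟨hx.2, lt_of_not_ge fun h => not_lt_of_ge (hF ht hx.2 h) hx.1⟩
  exact (measure_mono this).trans (by simp)

end Rearrangement

/-! ### The Hardy–Littlewood inequality -/

section HardyLittlewood

variable {α : Type*} [MeasurableSpace α] {μ : Measure α}

/-- Layer cake formula with respect to a weight `v`. -/
theorem lintegral_mul_eq_layer [SFinite μ] {u v : α → ℝ≥0∞} (hu : AEMeasurable u μ)
    (hv : AEMeasurable v μ) :
    ∫⁻ x, u x * v x ∂μ =
      ∫⁻ l, ∫⁻ x in {x | ENNReal.ofReal l < u x}, v x ∂μ ∂halfLine := by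
  wlog hum : Measurable u generalizing u
  · rw [lintegral_congr_ae (g := fun x => hu.mk u x * v x)
      (hu.ae_eq_mk.mono fun x hx => by simp only [hx]), this hu.measurable_mk.aemeasurable
      hu.measurable_mk]
    refine lintegral_congr fun l => setLIntegral_congr ?_
    filter_upwards [hu.ae_eq_mk] with x hx
    change (_ < _) = (_ < _)
    rw [hx]
  wlog hvm : Measurable v generalizing v
  · rw [lintegral_congr_ae (g := fun x => u x * hv.mk v x)
      (hv.ae_eq_mk.mono fun x hx => by simp only [hx]), this hv.measurable_mk.aemeasurable
      hv.measurable_mk]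
    refine lintegral_congr fun l => lintegral_congr_ae ?_
    exact ae_restrict_of_ae (hv.ae_eq_mk.symm)
  have hset : MeasurableSet {p : α × ℝ | ENNReal.ofReal p.2 < u p.1} :=
    measurableSet_lt (ENNReal.measurable_ofReal.comp measurable_snd) (hum.comp measurable_fst)
  have h1 : ∀ x, u x * v x = ∫⁻ l, {p : α × ℝ | ENNReal.ofReal p.2 < u p.1}.indicator
      (fun p => v p.1) (x, l) ∂halfLine := fun x => by
    have : ∀ l : ℝ, {p : α × ℝ | ENNReal.ofReal p.2 < u p.1}.indicator (fun p => v p.1) (x, l)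
        = {l : ℝ | ENNReal.ofReal l < u x}.indicator (fun _ => v x) l := fun l => rfl
    simp only [this]
    rw [lintegral_indicator_const (measurableSet_lt ENNReal.measurable_ofReal measurable_const),
      halfLine_setOf_ofReal_lt, mul_comm]
  simp only [h1]
  rw [lintegral_lintegral_swap (f := fun x l => {p : α × ℝ | ENNReal.ofReal p.2 < u p.1}.indicator
    (fun p => v p.1) (x, l)) ((hvm.comp measurable_fst).indicator hset).aemeasurable]
  refine lintegral_congr fun l => ?_
  have : ∀ x : α, {p : α × ℝ | ENNReal.ofReal p.2 < u p.1}.indicator (fun p => v p.1) (x, l)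
      = {x | ENNReal.ofReal l < u x}.indicator v x := fun x => rfl
  simp only [this]
  rw [lintegral_indicator (measurableSet_lt measurable_const hum)]

/-- Bathtub principle: among the sets of a given measure, the integral of a nonincreasing function
is largest over the initial interval. -/
theorem setLIntegral_comp_le_of_antitoneOn {V : α → ℝ} (hV : MeasurePreserving V μ halfLine)
    {W : ℝ → ℝ≥0∞} (hW : AntitoneOn W (Ioi 0)) {E : Set α} (hE : NullMeasurableSet E μ) :
    ∫⁻ x in E, W (V x) ∂μ ≤ ∫⁻ t in {t | ENNReal.ofReal t < μ E}, W t ∂halfLine := by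
  wlog hEm : MeasurableSet E generalizing E
  · obtain ⟨E', -, hE', hEE'⟩ := hE.exists_measurable_superset_ae_eq
    rw [← setLIntegral_congr hEE', ← measure_congr hEE']
    exact this hE'.nullMeasurableSet hE'
  have hWm : AEMeasurable W halfLine := aemeasurable_restrict_of_antitoneOn measurableSet_Ioi hW
  have hcomp : ∀ A : Set ℝ, MeasurableSet A →
      ∫⁻ x in V ⁻¹' A, W (V x) ∂μ = ∫⁻ t in A, W t ∂halfLine := fun A hA => by
    have h := hV.restrict_preimage hA
    rw [← h.map_eq, lintegral_map' (by rw [h.map_eq]; exact hWm.restrict) h.measurable.aemeasurable]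
  have hAm : MeasurableSet {t : ℝ | ENNReal.ofReal t < μ E} :=
    measurableSet_lt ENNReal.measurable_ofReal measurable_const
  rcases eq_or_ne (μ E) ∞ with htop | htop
  · rw [← hcomp _ hAm]
    refine lintegral_mono_set fun x _ => ?_
    simp [htop]
  set m : ℝ := (μ E).toReal with hm
  set D := V ⁻¹' {t : ℝ | ENNReal.ofReal t < μ E} with hD
  have hDm : MeasurableSet D := hV.measurable hAm
  have hDE : μ D = μ E := by
    rw [hD, hV.measure_preimage hAm.nullMeasurableSet, halfLine_setOf_ofReal_lt]
  rw [← hcomp _ hAm, ← hD, ← lintegral_inter_add_sdiff _ E hDm,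
    ← lintegral_inter_add_sdiff _ D hEm, inter_comm D E]
  refine add_le_add_right ?_ _
  rcases eq_or_ne (μ E) 0 with h0 | h0
  · rw [Measure.restrict_eq_zero.2 (measure_mono_null sdiff_subset h0)]
    simp
  have hmpos : 0 < m := ENNReal.toReal_pos h0 htop
  have hdiff : μ (E \ D) = μ (D \ E) := by
    have h1 := measure_inter_add_sdiff₀ E hDm.nullMeasurableSet (μ := μ)
    have h2 := measure_inter_add_sdiff₀ D hE (μ := μ)
    rw [inter_comm] at h1
    rw [hDE, ← h1] at h2
    exact ((ENNReal.add_right_inj (measure_ne_top_of_subset inter_subset_right htop)).1 h2).symm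
  have hpos : ∀ᵐ x ∂μ, 0 < V x := by
    have := hV.quasiMeasurePreserving.ae (ae_restrict_mem measurableSet_Ioi)
    exact this
  calc ∫⁻ x in E \ D, W (V x) ∂μ ≤ ∫⁻ x in E \ D, W m ∂μ := by
        refine lintegral_mono_ae ?_
        filter_upwards [ae_restrict_of_ae hpos,
          ae_restrict_mem₀ (hE.diff hDm.nullMeasurableSet)] with x hx hxE
        refine hW hmpos hx ?_
        have : μ E ≤ ENNReal.ofReal (V x) := not_lt.1 hxE.2
        exact ENNReal.toReal_le_of_le_ofReal hx.le this
    _ = ∫⁻ x in D \ E, W m ∂μ := by simp [hdiff]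
    _ ≤ ∫⁻ x in D \ E, W (V x) ∂μ := by
        refine lintegral_mono_ae ?_
        filter_upwards [ae_restrict_of_ae hpos,
          ae_restrict_mem₀ (hDm.nullMeasurableSet.diff hE)] with x hx hxE
        refine hW hx hmpos ?_
        have : ENNReal.ofReal (V x) < μ E := hxE.1
        exact ((ENNReal.ofReal_lt_iff_lt_toReal hx.le htop).1 this).le

/-- Hardy–Littlewood inequality, in the case where one factor is a nonincreasing function of a
measure-preserving map to the half-line. -/
theorem lintegral_mul_comp_le_rearr [SFinite μ] {V : α → ℝ} (hV : MeasurePreserving V μ halfLine)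
    {W : ℝ → ℝ≥0∞} (hW : AntitoneOn W (Ioi 0)) {u : α → ℝ≥0∞} (hu : AEMeasurable u μ) :
    ∫⁻ x, u x * W (V x) ∂μ ≤ ∫⁻ t, rearr μ u t * W t ∂halfLine := by
  have hWm : AEMeasurable W halfLine := aemeasurable_restrict_of_antitoneOn measurableSet_Ioi hW
  rw [lintegral_mul_eq_layer (v := fun x => W (V x)) hu
      (hWm.comp_quasiMeasurePreserving hV.quasiMeasurePreserving),
    lintegral_mul_eq_layer (rearr_antitone u).measurable.aemeasurable hWm]
  refine lintegral_mono fun l => ?_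
  simp only [lt_rearr_iff]
  exact setLIntegral_comp_le_of_antitoneOn hV hW
    (hu.nullMeasurableSet_preimage measurableSet_Ioi)

theorem lintegral_mul_le_rearr {W : ℝ → ℝ≥0∞} (hW : AntitoneOn W (Ioi 0)) {u : ℝ → ℝ≥0∞}
    (hu : AEMeasurable u halfLine) :
    ∫⁻ t, u t * W t ∂halfLine ≤ ∫⁻ t, rearr halfLine u t * W t ∂halfLine :=
  lintegral_mul_comp_le_rearr (MeasurePreserving.id halfLine) hW hu

end HardyLittlewood

/-! ### Rearrangement-invariant norms and their associate norms -/

namespace IsRearrangementInvariantNorm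

variable {α β : Type*} [MeasurableSpace α] [MeasurableSpace β] {μ : Measure α} {ν : Measure β}
  {ρ : (α → ℝ≥0∞) → ℝ≥0∞}

theorem map_zero (hρ : IsRearrangementInvariantNorm μ ρ) : ρ (fun _ => 0) = 0 :=
  (hρ.eq_zero_iff _ aemeasurable_const).2 Filter.EventuallyEq.rfl

theorem sum_le (hρ : IsRearrangementInvariantNorm μ ρ) {ι : Type*} (s : Finset ι)
    {f : ι → α → ℝ≥0∞} (hf : ∀ i, AEMeasurable (f i) μ) :
    ρ (fun x => ∑ i ∈ s, f i x) ≤ ∑ i ∈ s, ρ (f i) := by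
  classical
  induction s using Finset.induction_on with
  | empty => simp [hρ.map_zero]
  | insert i s his ih =>
    simp only [Finset.sum_insert his]
    exact (hρ.add_le _ _ (hf i) (Finset.aemeasurable_fun_sum s fun i _ => hf i)).trans
      (by gcongr)

/-- Hölder's inequality. The norm of `u` is assumed to be finite to exclude the product `∞ * 0`. -/
theorem lintegral_mul_le (hρ : IsRearrangementInvariantNorm μ ρ) {u : α → ℝ≥0∞}
    (hu : AEMeasurable u μ) (hfin : ρ u ≠ ∞) (g : α → ℝ≥0∞) :
    ∫⁻ x, u x * g x ∂μ ≤ ρ u * assocNorm μ ρ g := by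
  rcases eq_or_ne (ρ u) 0 with h0 | h0
  · have hz : (fun x => u x * g x) =ᵐ[μ] 0 := by
      filter_upwards [(hρ.eq_zero_iff u hu).1 h0] with x hx
      rw [hx, Pi.zero_apply, zero_mul]
    rw [lintegral_congr_ae hz, h0]
    simp
  lift ρ u to ℝ≥0 using hfin with A hA
  have hA0 : A ≠ 0 := by exact_mod_cast h0
  have h1 : ρ (fun x => (A⁻¹ : ℝ≥0) * u x) ≤ 1 := by
    rw [hρ.smul _ _ hu, ← hA, ← ENNReal.coe_mul, inv_mul_cancel₀ hA0, ENNReal.coe_one]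
  have h2 : ∫⁻ x, ((A⁻¹ : ℝ≥0) * u x) * g x ∂μ ≤ assocNorm μ ρ g :=
    le_iSup₂_of_le _ (hu.const_mul _) (le_iSup_of_le h1 le_rfl)
  calc ∫⁻ x, u x * g x ∂μ = ∫⁻ x, A * (((A⁻¹ : ℝ≥0) * u x) * g x) ∂μ := by
        refine lintegral_congr fun x => ?_
        rw [← mul_assoc, ← mul_assoc, ← ENNReal.coe_mul, mul_inv_cancel₀ hA0, ENNReal.coe_one,
          one_mul]
    _ = A * ∫⁻ x, ((A⁻¹ : ℝ≥0) * u x) * g x ∂μ := lintegral_const_mul' _ _ (by simp)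
    _ ≤ _ := by gcongr

theorem assocNorm_mono {f g : α → ℝ≥0∞} (h : f ≤ᵐ[μ] g) : assocNorm μ ρ f ≤ assocNorm μ ρ g :=
  iSup_mono fun u => iSup_mono fun _ => iSup_mono fun _ => lintegral_mono_ae <| by
    filter_upwards [h] with x hx
    gcongr

/-- A measure-preserving map transports rearrangement-invariant norms forward. -/
theorem comp (hρ : IsRearrangementInvariantNorm μ ρ) {V : α → β} (hV : MeasurePreserving V μ ν) :
    IsRearrangementInvariantNorm ν (fun F => ρ (F ∘ V)) := by
  have hm : ∀ {F : β → ℝ≥0∞}, AEMeasurable F ν → AEMeasurable (F ∘ V) μ := fun hF =>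
    hF.comp_quasiMeasurePreserving hV.quasiMeasurePreserving
  refine ⟨fun F hF => ?_, fun c F hF => hρ.smul c _ (hm hF),
    fun F G hF hG => hρ.add_le _ _ (hm hF) (hm hG), fun F G hF hG h => ?_, fun F G hF hG h => ?_,
    fun E hE hEt => ?_, fun E hE hEt => ?_, fun F G hF hG h => ?_⟩
  · rw [hρ.eq_zero_iff _ (hm hF)]
    have h := hV.measure_preimage (hF.nullMeasurableSet_preimage (measurableSet_singleton 0).compl)
    simp only [Filter.EventuallyEq, ae_iff]
    exact Iff.of_eq (congrArg (· = 0) h)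
  · exact hρ.mono _ _ (hm hF) (hm hG) (hV.quasiMeasurePreserving.ae h)
  · exact hρ.fatou _ _ (fun j => hm (hF j)) (hm hG) (hV.quasiMeasurePreserving.ae h)
  · have := hρ.indicator_lt_top (V ⁻¹' E) (hE.preimage hV.quasiMeasurePreserving)
      (by rwa [hV.measure_preimage hE])
    exact this
  · obtain ⟨C, hC⟩ := hρ.local_embedding (V ⁻¹' E) (hE.preimage hV.quasiMeasurePreserving)
      (by rwa [hV.measure_preimage hE])
    refine ⟨C, fun F hF => le_of_eq_of_le ?_ (hC _ (hm hF))⟩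
    rw [← lintegral_indicator₀ hE, ← lintegral_indicator₀ (hE.preimage hV.quasiMeasurePreserving),
      ← hV.map_eq, lintegral_map' (by rw [hV.map_eq]; exact hF.indicator₀ hE)
        hV.measurable.aemeasurable]
    rfl
  · exact hρ.rearrangement_invariant _ _ (hm hF) (hm hG)
      (((hV.equimeasurable_comp hF).trans h).trans (hV.equimeasurable_comp hG).symm)

/-- Against a nonincreasing function of a measure-preserving map `V` onto the half-line, the
associate norm is computed on the half-line; this is the Hardy–Littlewood inequality. -/
theorem assocNorm_comp [SFinite μ] (hρ : IsRearrangementInvariantNorm μ ρ) {V : α → ℝ}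
    (hV : MeasurePreserving V μ halfLine) {G : ℝ → ℝ≥0∞} (hG : AntitoneOn G (Ioi 0)) :
    assocNorm μ ρ (G ∘ V) = assocNorm halfLine (fun F => ρ (F ∘ V)) G := by
  have hGm : AEMeasurable G halfLine := aemeasurable_restrict_of_antitoneOn measurableSet_Ioi hG
  apply le_antisymm
  · refine iSup_le fun u => iSup_le fun hu => iSup_le fun hu1 => ?_
    have hr : AEMeasurable (rearr μ u) halfLine := (rearr_antitone u).measurable.aemeasurable
    refine (lintegral_mul_comp_le_rearr hV hG hu).trans
      (le_iSup₂_of_le (rearr μ u) hr (le_iSup_of_le (hu1.trans' (le_of_eq ?_)) le_rfl))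
    exact hρ.rearrangement_invariant _ _
      (hr.comp_quasiMeasurePreserving hV.quasiMeasurePreserving) hu
      ((hV.equimeasurable_comp hr).trans (equimeasurable_rearr u))
  · refine iSup_le fun F => iSup_le fun hF => iSup_le fun hF1 => ?_
    refine le_iSup₂_of_le (F ∘ V) (hF.comp_quasiMeasurePreserving hV.quasiMeasurePreserving)
      (le_iSup_of_le hF1 (le_of_eq ?_))
    rw [← hV.map_eq, lintegral_map' (by rw [hV.map_eq]; exact hF.mul hGm)
        hV.measurable.aemeasurable]
    rfl

theorem rearr_eq_norm {σ : (ℝ → ℝ≥0∞) → ℝ≥0∞} (hσ : IsRearrangementInvariantNorm halfLine σ)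
    {F : ℝ → ℝ≥0∞} (hF : AEMeasurable F halfLine) : σ (rearr halfLine F) = σ F :=
  hσ.rearrangement_invariant _ _ (rearr_antitone F).measurable.aemeasurable hF
    (equimeasurable_rearr F)

end IsRearrangementInvariantNorm

/-! ### The representation space -/

section Representation

variable {n : ℕ}

/-- The volume of the ball centered at the origin whose boundary contains `x`. As a map to the
half-line it is measure preserving, so that `F ↦ F ∘ ballVolume` identifies functions on the
half-line with radial functions. -/
noncomputable def ballVolume (x : EuclideanSpace ℝ (Fin n)) : ℝ :=
  (volume (Metric.ball (0 : EuclideanSpace ℝ (Fin n)) ‖x‖)).toReal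

theorem measurePreserving_ballVolume (hn : 0 < n) :
    MeasurePreserving (ballVolume (n := n)) volume halfLine := by
  have : NeZero n := ⟨hn.ne'⟩
  have : Nontrivial (EuclideanSpace ℝ (Fin n)) := by
    refine Module.nontrivial_of_finrank_pos (R := ℝ) ?_
    simpa using hn
  set c : ℝ := (volume (Metric.ball (0 : EuclideanSpace ℝ (Fin n)) 1)).toReal with hc
  have hctop : volume (Metric.ball (0 : EuclideanSpace ℝ (Fin n)) 1) ≠ ∞ :=
    measure_ball_lt_top.ne
  have hcpos : 0 < c :=
    ENNReal.toReal_pos (Metric.measure_ball_pos volume _ one_pos).ne' hctop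
  have hV : ∀ x : EuclideanSpace ℝ (Fin n), ballVolume x = ‖x‖ ^ n * c := fun x => by
    rw [ballVolume, Measure.addHaar_ball volume _ (norm_nonneg x), ENNReal.toReal_mul,
      ENNReal.toReal_ofReal (by positivity), finrank_euclideanSpace_fin]
  have hVm : Measurable (ballVolume (n := n)) := by
    have : ballVolume (n := n) = fun x => ‖x‖ ^ n * c := funext hV
    rw [this]; fun_prop
  have hIic : ∀ b : ℝ, volume (ballVolume (n := n) ⁻¹' Iic b) = ENNReal.ofReal b := fun b => by
    rcases lt_or_ge b 0 with hb | hb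
    · have : ballVolume (n := n) ⁻¹' Iic b = ∅ := by
        ext x
        simp only [mem_preimage, mem_Iic, mem_empty_iff_false, iff_false, not_le]
        exact hb.trans_le ENNReal.toReal_nonneg
      rw [this, measure_empty, ENNReal.ofReal_of_nonpos hb.le]
    · set R : ℝ := (b / c) ^ ((n : ℝ)⁻¹) with hR
      have hR0 : 0 ≤ R := by positivity
      have hRn : R ^ n = b / c := by
        rw [hR]; exact Real.rpow_inv_natCast_pow (by positivity) hn.ne'
      have : ballVolume (n := n) ⁻¹' Iic b = Metric.closedBall 0 R := by
        ext x
        simp only [mem_preimage, mem_Iic, mem_closedBall_zero_iff, hV]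
        rw [← le_div_iff₀ hcpos, ← hRn]
        exact pow_le_pow_iff_left₀ (norm_nonneg x) hR0 hn.ne'
      rw [this, Measure.addHaar_closedBall volume _ hR0, finrank_euclideanSpace_fin, hRn,
        ← ENNReal.ofReal_toReal hctop, ← hc, ← ENNReal.ofReal_mul (by positivity),
        div_mul_cancel₀ _ hcpos.ne']
  refine ⟨hVm, (Measure.ext_of_Ioc halfLine _ fun a b hab => ?_).symm⟩
  rw [Measure.map_apply hVm measurableSet_Ioc, Measure.restrict_apply measurableSet_Ioc]
  have h1 : Ioc a b ∩ Ioi 0 = Ioc (max a 0) b := by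
    rw [Ioc_inter_Ioi]
  have h2 : ballVolume (n := n) ⁻¹' Ioc a b
      = ballVolume (n := n) ⁻¹' Iic b \ ballVolume (n := n) ⁻¹' Iic a := by
    ext x
    simp [and_comm]
  rw [h1, Real.volume_Ioc, h2, measure_sdiff (preimage_mono (Iic_subset_Iic.2 hab.le))
    (hVm measurableSet_Iic).nullMeasurableSet (by simp [hIic]), hIic, hIic]
  rcases le_total a 0 with ha | ha
  · rw [max_eq_right ha, ENNReal.ofReal_of_nonpos ha, sub_zero, tsub_zero]
  · rw [max_eq_left ha, ENNReal.ofReal_sub _ ha]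

theorem reprNorm_eq_comp_ballVolume (hn : 0 < n) {ρ : (EuclideanSpace ℝ (Fin n) → ℝ≥0∞) → ℝ≥0∞}
    (hρ : IsRearrangementInvariantNorm volume ρ) {F : ℝ → ℝ≥0∞} (hF : AEMeasurable F halfLine) :
    reprNorm ρ F = ρ (F ∘ ballVolume) :=
  (hρ.comp (measurePreserving_ballVolume hn)).rearr_eq_norm hF

theorem reprNorm_assocNorm (hn : 0 < n) {ρ : (EuclideanSpace ℝ (Fin n) → ℝ≥0∞) → ℝ≥0∞}
    (hρ : IsRearrangementInvariantNorm volume ρ) (F : ℝ → ℝ≥0∞) :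
    reprNorm (assocNorm volume ρ) F =
      assocNorm halfLine (fun F => ρ (F ∘ ballVolume)) (rearr halfLine F) := by
  change assocNorm volume ρ (rearr halfLine F ∘ ballVolume) = _
  exact hρ.assocNorm_comp (measurePreserving_ballVolume hn) ((rearr_antitone F).antitoneOn _)

end Representation

/-! ### Averages over the cells of a grid -/

section Cells

/-- The step function taking the value `x c` on the cell `[c δ, (c + 1) δ)`. -/
noncomputable def cellStep (δ : ℝ) (x : ℕ → ℝ≥0∞) (t : ℝ) : ℝ≥0∞ := x ⌊t / δ⌋₊

/-- The mean value of `u` over the cell `[c δ, (c + 1) δ)`. -/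
noncomputable def cellAvg (δ : ℝ) (u : ℝ → ℝ≥0∞) (c : ℕ) : ℝ≥0∞ :=
  (ENNReal.ofReal δ)⁻¹ * ∫⁻ t in Ico (c * δ) ((c + 1) * δ), u t

theorem measurable_cellStep (δ : ℝ) (x : ℕ → ℝ≥0∞) : Measurable (cellStep δ x) :=
  (measurable_of_countable x).comp (Nat.measurable_floor.comp (measurable_id.div_const δ))

variable {δ : ℝ}

theorem floor_div_eq_of_mem_cell (hδ : 0 < δ) {c : ℕ} {t : ℝ}
    (ht : t ∈ Ico (c * δ) ((c + 1) * δ)) : ⌊t / δ⌋₊ = c := by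
  have h0 : 0 ≤ t := le_trans (by positivity) ht.1
  rw [Nat.floor_eq_iff (by positivity), le_div_iff₀ hδ, div_lt_iff₀ hδ]
  exact ht

theorem lintegral_halfLine_eq_tsum (hδ : 0 < δ) (F : ℝ → ℝ≥0∞) :
    ∫⁻ t, F t ∂halfLine = ∑' c : ℕ, ∫⁻ t in Ico (c * δ) ((c + 1) * δ), F t := by
  have h1 : (Ici (0 : ℝ)) = ⋃ c : ℕ, Ico (c * δ) ((c + 1) * δ) := by
    ext t
    simp only [mem_Ici, mem_iUnion]
    refine ⟨fun ht => ⟨⌊t / δ⌋₊, ?_, ?_⟩, fun ⟨c, hc⟩ => le_trans (by positivity) hc.1⟩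
    · rw [← le_div_iff₀ hδ]; exact Nat.floor_le (by positivity)
    · rw [← div_lt_iff₀ hδ]; exact Nat.lt_floor_add_one _
  rw [halfLine, Measure.restrict_congr_set Ioi_ae_eq_Ici, h1,
    lintegral_iUnion (fun _ => measurableSet_Ico)]
  intro i j hij
  refine disjoint_left.2 fun t hi hj => hij ?_
  rw [← floor_div_eq_of_mem_cell hδ hi, floor_div_eq_of_mem_cell hδ hj]

theorem lintegral_cellStep_mul (hδ : 0 < δ) (x : ℕ → ℝ≥0∞) {F : ℝ → ℝ≥0∞}
    (hF : AEMeasurable F halfLine) :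
    ∫⁻ t, cellStep δ x t * F t ∂halfLine =
      ∑' c : ℕ, x c * ∫⁻ t in Ico (c * δ) ((c + 1) * δ), F t := by
  rw [lintegral_halfLine_eq_tsum hδ]
  refine tsum_congr fun c => ?_
  rw [← lintegral_const_mul'']
  · refine setLIntegral_congr_fun measurableSet_Ico fun t ht => ?_
    simp only [cellStep, floor_div_eq_of_mem_cell hδ ht]
  · refine AEMeasurable.mono_measure ?_ (Measure.restrict_mono
      (show Ico ((c : ℝ) * δ) ((c + 1) * δ) ⊆ Ici 0 from fun t ht => ?_) le_rfl)
    · rw [Measure.restrict_congr_set Ioi_ae_eq_Ici.symm]; exact hF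
    · exact le_trans (by positivity) ht.1

theorem lintegral_cellStep (hδ : 0 < δ) (x : ℕ → ℝ≥0∞) :
    ∫⁻ t, cellStep δ x t ∂halfLine = ∑' c : ℕ, x c * ENNReal.ofReal δ := by
  have h := lintegral_cellStep_mul hδ x (F := fun _ => 1) aemeasurable_const
  simp only [mul_one, lintegral_const, Measure.restrict_apply_univ, one_mul, Real.volume_Ico] at h
  rw [h]
  congr! 4
  ring

theorem halfLine_lt_cellStep (hδ : 0 < δ) (x : ℕ → ℝ≥0∞) (s : ℝ≥0∞) :
    halfLine {t | s < cellStep δ x t} =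
      ∑' c : ℕ, (Ioi s).indicator 1 (x c) * ENNReal.ofReal δ := by
  rw [← lintegral_cellStep hδ,
    ← lintegral_indicator_one (measurableSet_lt measurable_const (measurable_cellStep δ x))]
  rfl

theorem equimeasurable_cellStep_perm (hδ : 0 < δ) (x : ℕ → ℝ≥0∞) (e : Equiv.Perm ℕ) :
    Equimeasurable halfLine halfLine (cellStep δ (x ∘ e)) (cellStep δ x) :=
  equimeasurable_iff.2 fun s => by
    rw [halfLine_lt_cellStep hδ, halfLine_lt_cellStep hδ]
    exact e.tsum_eq fun c => (Ioi s).indicator 1 (x c) * ENNReal.ofReal δ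

theorem cellStep_mono {x y : ℕ → ℝ≥0∞} (h : x ≤ y) : cellStep δ x ≤ cellStep δ y := fun _ => h _

theorem cellStep_div_natCast (x : ℕ → ℝ≥0∞) {L : ℕ} (hL : L ≠ 0) :
    cellStep (δ / L) (fun c => x (c / L)) = cellStep δ x := by
  funext t
  simp only [cellStep]
  rw [← Nat.floor_div_natCast]
  congr 2
  field_simp

theorem setLIntegral_Ico_le_sum {u : ℝ → ℝ≥0∞} (hu : AntitoneOn u (Ioi 0)) {A η : ℝ} (hA : 0 < A)
    (hη : 0 ≤ η) (K : ℕ) :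
    ∫⁻ t in Ico A (A + K * η), u t ≤ ∑ p ∈ Finset.range K, ENNReal.ofReal η * u (A + p * η) := by
  induction K with
  | zero => simp
  | succ K ih =>
    have hpos : 0 < A + K * η := by positivity
    rw [Finset.sum_range_succ, ← Ico_union_Ico_eq_Ico (b := A + K * η)
      (by linarith [show 0 ≤ K * η by positivity]) (by push_cast; linarith)]
    refine (lintegral_union_le _ _ _).trans (add_le_add ih ?_)
    calc ∫⁻ t in Ico (A + K * η) (A + (K + 1 : ℕ) * η), u t
        ≤ ∫⁻ t in Ico (A + K * η) (A + (K + 1 : ℕ) * η), u (A + K * η) :=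
          setLIntegral_mono' measurableSet_Ico fun t ht => hu hpos (hpos.trans_le ht.1) ht.1
      _ = ENNReal.ofReal η * u (A + K * η) := by
          rw [setLIntegral_const, Real.volume_Ico, mul_comm]
          congr 2
          push_cast; ring

/-- Averaging a nonincreasing function over the cells of a grid does not increase its norm. A finer
grid gives a step function below `u`, whose cyclic permutations inside the cells are equimeasurable
and have a mean that is constant on cells and close to the cell averages. -/
theorem IsRearrangementInvariantNorm.cellAvg_le {σ : (ℝ → ℝ≥0∞) → ℝ≥0∞}
    (hσ : IsRearrangementInvariantNorm halfLine σ) (hδ : 0 < δ) {u : ℝ → ℝ≥0∞}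
    (hu : AntitoneOn u (Ioi 0)) : σ (cellStep δ (cellAvg δ u)) ≤ σ u := by
  have hum : AEMeasurable u halfLine := aemeasurable_restrict_of_antitoneOn measurableSet_Ioi hu
  have hcm : ∀ (δ : ℝ) x, AEMeasurable (cellStep δ x) halfLine := fun δ x =>
    (measurable_cellStep δ x).aemeasurable
  -- Integrals over the cells without their left ends: the fine lower step functions see these.
  let z : ℕ → ℕ → ℝ≥0∞ := fun j b =>
    (ENNReal.ofReal δ)⁻¹ * ∫⁻ t in Ico (b * δ + δ / (j + 1 : ℕ)) ((b + 1) * δ), u t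
  have hz : ∀ j, σ (cellStep δ (z j)) ≤ σ u := fun j => by
    set L : ℕ := j + 1 with hL
    have hL0 : (0 : ℝ) < L := by positivity
    set η : ℝ := δ / L with hη
    have hη0 : 0 < η := by positivity
    have hLη : L * η = δ := by rw [hη]; field_simp
    let x : ℕ → ℝ≥0∞ := fun c => u ((c + 1) * η)
    let e : Fin L → Equiv.Perm ℕ := fun q =>
      ((Nat.divModEquiv L).trans ((Equiv.refl ℕ).prodCongr (Equiv.addRight q))).trans
        (Nat.divModEquiv L).symm
    let Y : ℕ → ℝ≥0∞ := fun b => ∑ p : Fin L, x ((Nat.divModEquiv L).symm (b, p))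
    have hY : ∀ c, ∑ q, x (e q c) = Y (c / L) := fun c =>
      Equiv.sum_comp (Equiv.addLeft (Nat.divModEquiv L c).2)
        (fun p => x ((Nat.divModEquiv L).symm (c / L, p)))
    have hxu : σ (cellStep η x) ≤ σ u := by
      refine hσ.mono _ _ (hcm _ _) hum ?_
      filter_upwards [ae_restrict_mem measurableSet_Ioi] with t ht
      have ht' : 0 < t := ht
      refine hu ht (mem_Ioi.2 (by positivity)) ?_
      rw [← div_le_iff₀ hη0]
      exact (Nat.lt_floor_add_one _).le
    have hzY : z j ≤ fun b => ((L : ℝ≥0)⁻¹ : ℝ≥0) * Y b := fun b => by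
      have hA : 0 < b * δ + η := by positivity
      have h1 : ∫⁻ t in Ico (b * δ + η) ((b + 1) * δ), u t ≤ ENNReal.ofReal η * Y b := by
        refine (lintegral_mono_set (Ico_subset_Ico_right
          (show (b + 1) * δ ≤ b * δ + η + L * η by linarith))).trans
          ((setLIntegral_Ico_le_sum hu hA hη0.le L).trans (le_of_eq ?_))
        rw [Finset.mul_sum, ← Fin.sum_univ_eq_sum_range (fun p => ENNReal.ofReal η *
          u (b * δ + η + p * η)) L]
        refine Finset.sum_congr rfl fun p _ => ?_
        simp only [x, Nat.divModEquiv_symm_apply]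
        congr 2
        push_cast
        rw [← hLη]
        ring
      calc z j b ≤ (ENNReal.ofReal δ)⁻¹ * (ENNReal.ofReal η * Y b) := by
            simp only [z]; gcongr
        _ = _ := by
            rw [← mul_assoc]
            congr 1
            rw [ENNReal.coe_inv (by positivity), hη, ENNReal.ofReal_div_of_pos hL0,
              ENNReal.ofReal_natCast, div_eq_mul_inv, ← mul_assoc,
              ENNReal.inv_mul_cancel (by simpa using hδ) ENNReal.ofReal_ne_top, one_mul]
            simp
    calc σ (cellStep δ (z j)) ≤ σ (cellStep δ fun b => ((L : ℝ≥0)⁻¹ : ℝ≥0) * Y b) :=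
          hσ.mono _ _ (hcm _ _) (hcm _ _) (Filter.Eventually.of_forall (cellStep_mono hzY))
      _ = σ (fun t => ((L : ℝ≥0)⁻¹ : ℝ≥0) * ∑ q, cellStep η (x ∘ e q) t) := by
          congr 1
          rw [← cellStep_div_natCast _ (L := L) (by omega)]
          funext t
          simp only [cellStep, ← hY, Function.comp_apply]
          rfl
      _ ≤ ((L : ℝ≥0)⁻¹ : ℝ≥0) * ∑ q, σ (cellStep η (x ∘ e q)) := by
          rw [hσ.smul _ _ (Finset.aemeasurable_fun_sum _ fun q _ => hcm _ _)]
          gcongr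
          exact hσ.sum_le _ fun q => hcm _ _
      _ = ((L : ℝ≥0)⁻¹ : ℝ≥0) * ∑ q : Fin L, σ (cellStep η x) := by
          congr 1
          exact Finset.sum_congr rfl fun q _ => hσ.rearrangement_invariant _ _ (hcm _ _) (hcm _ _)
            (equimeasurable_cellStep_perm hη0 x (e q))
      _ = σ (cellStep η x) := by
          rw [Finset.sum_const, Finset.card_univ, Fintype.card_fin, nsmul_eq_mul, ← mul_assoc,
            ENNReal.coe_inv (by positivity), ENNReal.coe_natCast,
            ENNReal.inv_mul_cancel (by simp [hL]) (by simp), one_mul]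
      _ ≤ σ u := hxu
  have hmono : ∀ b, Monotone fun j : ℕ => Ico (b * δ + δ / (j + 1 : ℕ)) ((b + 1) * δ) :=
    fun b i j hij => Ico_subset_Ico_left (by gcongr)
  rw [← hσ.fatou (fun j => cellStep δ (z j)) _ (fun j => hcm _ _) (hcm _ _)]
  · exact iSup_le hz
  refine Filter.Eventually.of_forall fun t => ⟨fun i j hij => ?_, ?_⟩
  · simp only [cellStep, z]
    exact mul_le_mul_right (lintegral_mono_set (hmono _ hij)) _
  · simp only [cellStep, z, cellAvg]
    rw [← ENNReal.mul_iSup]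
    congr 1
    set b : ℕ := ⌊t / δ⌋₊
    rw [← setLIntegral_iUnion_of_directed _ ((hmono b).directed_le),
      setLIntegral_congr (Ioo_ae_eq_Ico (a := (b : ℝ) * δ)).symm]
    congr 2
    ext s
    simp only [mem_iUnion, mem_Ico, mem_Ioo, exists_and_right]
    refine and_congr_left fun _ => ⟨fun ⟨j, hj⟩ => ?_, fun hs => ?_⟩
    · have : 0 < δ / (j + 1 : ℕ) := by positivity
      linarith
    · obtain ⟨j, hj⟩ := exists_nat_one_div_lt (show 0 < (s - b * δ) / δ by
        exact div_pos (by linarith) hδ)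
      refine ⟨j, ?_⟩
      rw [lt_div_iff₀ hδ] at hj
      have : δ / (j + 1 : ℕ) = 1 / ((j : ℝ) + 1) * δ := by push_cast; ring
      linarith

end Cells

/-! ### Duality for nonincreasing functions -/

section Duality

variable {σ : (ℝ → ℝ≥0∞) → ℝ≥0∞} {δ : ℝ} {N : ℕ}

/-- The sequence of absolute values of a finite vector, extended by zero. -/
noncomputable def absExtend (v : Fin N → ℝ) (c : ℕ) : ℝ≥0∞ :=
  if h : c < N then ENNReal.ofReal |v ⟨c, h⟩| else 0

theorem absExtend_perm (v : Fin N → ℝ) (e : Equiv.Perm (Fin N)) :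
    absExtend (v ∘ e) = absExtend v ∘ e.extendDomain Fin.equivSubtype := by
  funext c
  by_cases hc : c < N
  · have h := e.extendDomain_apply_subtype Fin.equivSubtype (b := c) hc
    have h2 : e.extendDomain Fin.equivSubtype c = (e ⟨c, hc⟩ : ℕ) := h
    simp [absExtend, hc, h2]
  · have h := e.extendDomain_apply_not_subtype Fin.equivSubtype (b := c) hc
    simp [absExtend, hc, h]

theorem absExtend_mono {v w : Fin N → ℝ} (h : ∀ i, |v i| ≤ |w i|) :
    absExtend v ≤ absExtend w := fun c => by
  simp only [absExtend]
  split_ifs with hc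
  · exact ENNReal.ofReal_le_ofReal (h _)
  · exact le_rfl

theorem absExtend_smul (a : ℝ) (v : Fin N → ℝ) (c : ℕ) :
    absExtend (a • v) c = ENNReal.ofReal |a| * absExtend v c := by
  simp only [absExtend]
  split_ifs with hc
  · rw [← ENNReal.ofReal_mul (abs_nonneg a), ← abs_mul]; rfl
  · simp

theorem absExtend_add_le (v w : Fin N → ℝ) (c : ℕ) :
    absExtend (v + w) c ≤ absExtend v c + absExtend w c := by
  simp only [absExtend]
  split_ifs with hc
  · rw [← ENNReal.ofReal_add (abs_nonneg _) (abs_nonneg _)]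
    exact ENNReal.ofReal_le_ofReal (abs_add_le _ _)
  · simp

namespace IsRearrangementInvariantNorm

theorem cellStep_mono (hσ : IsRearrangementInvariantNorm halfLine σ) {x y : ℕ → ℝ≥0∞}
    (h : x ≤ y) : σ (cellStep δ x) ≤ σ (cellStep δ y) :=
  hσ.mono _ _ (measurable_cellStep δ x).aemeasurable (measurable_cellStep δ y).aemeasurable
    (Filter.Eventually.of_forall (_root_.cellStep_mono h))

theorem cellStep_absExtend_lt_top (hσ : IsRearrangementInvariantNorm halfLine σ) (hδ : 0 < δ)
    (v : Fin N → ℝ) : σ (cellStep δ (absExtend v)) < ∞ := by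
  set S : Set ℝ := {t | ⌊t / δ⌋₊ < N} with hS
  have hSm : MeasurableSet S := measurableSet_lt
    (Nat.measurable_floor.comp (measurable_id.div_const δ)) measurable_const
  have hSf : halfLine S < ∞ := by
    rw [Measure.restrict_apply hSm]
    refine (measure_mono (show S ∩ Ioi 0 ⊆ Ioo 0 (N * δ) from fun t ht => ⟨ht.2, ?_⟩)).trans_lt
      measure_Ioo_lt_top
    rw [← div_lt_iff₀ hδ]
    exact (Nat.floor_lt (div_nonneg (le_of_lt ht.2) hδ.le)).1 ht.1
  set M : ℝ≥0 := ∑ i, ‖v i‖₊ with hM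
  have hle : σ (cellStep δ (absExtend v)) ≤ σ (fun t => M * S.indicator 1 t) := by
    refine hσ.mono _ _ (measurable_cellStep δ _).aemeasurable
      ((measurable_one.indicator hSm).const_mul _).aemeasurable
      (Filter.Eventually.of_forall fun t => ?_)
    simp only [cellStep, absExtend]
    split_ifs with hc
    · rw [indicator_of_mem (show t ∈ S from hc), Pi.one_apply, mul_one, ← Real.norm_eq_abs,
        ofReal_norm, enorm_eq_nnnorm, ENNReal.coe_le_coe]
      exact Finset.single_le_sum (f := fun i => ‖v i‖₊) (fun i _ => zero_le)
        (Finset.mem_univ (⟨_, hc⟩ : Fin N))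
    · exact zero_le
  rw [hσ.smul _ _ (measurable_one.indicator hSm).aemeasurable] at hle
  exact hle.trans_lt (ENNReal.mul_lt_top ENNReal.coe_lt_top
    (hσ.indicator_lt_top S hSm.nullMeasurableSet hSf))

/-- Finite-dimensional duality: the norming functional of a nonincreasing vector, obtained from the
Hahn–Banach theorem, may be taken nonnegative and nonincreasing, because the norm is invariant under
permutations and changes of sign. -/
theorem exists_antitone_functional (hσ : IsRearrangementInvariantNorm halfLine σ) (hδ : 0 < δ)
    {x : Fin N → ℝ} (hx : Antitone x) (hx0 : 0 ≤ x) :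
    ∃ g : Fin N → ℝ, Antitone g ∧ 0 ≤ g ∧
      (∀ v : Fin N → ℝ, 0 ≤ v →
        ENNReal.ofReal (∑ i, g i * v i) ≤ σ (cellStep δ (absExtend v))) ∧
      σ (cellStep δ (absExtend x)) ≤ ENNReal.ofReal (∑ i, g i * x i) := by
  set p : (Fin N → ℝ) → ℝ := fun v => (σ (cellStep δ (absExtend v))).toReal with hp
  have htop : ∀ v : Fin N → ℝ, σ (cellStep δ (absExtend v)) ≠ ∞ := fun v =>
    (hσ.cellStep_absExtend_lt_top hδ v).ne
  have hofp : ∀ v, ENNReal.ofReal (p v) = σ (cellStep δ (absExtend v)) := fun v =>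
    ENNReal.ofReal_toReal (htop v)
  have hp_smul : ∀ (a : ℝ) v, p (a • v) = |a| * p v := fun a v => by
    have h1 : cellStep δ (absExtend (a • v)) =
        fun t => (Real.nnabs a : ℝ≥0) * cellStep δ (absExtend v) t := by
      funext t
      simp only [cellStep, absExtend_smul]
      rw [← Real.coe_nnabs, ENNReal.ofReal_coe_nnreal]
    simp only [hp]
    rw [h1, hσ.smul _ _ (measurable_cellStep δ _).aemeasurable, ENNReal.toReal_mul]
    rfl
  have hp_add : ∀ v w, p (v + w) ≤ p v + p w := fun v w => by
    simp only [hp]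
    rw [← ENNReal.toReal_add (htop v) (htop w)]
    refine ENNReal.toReal_mono (ENNReal.add_ne_top.2 ⟨htop v, htop w⟩) ?_
    refine (hσ.mono (cellStep δ (absExtend (v + w)))
      (fun t => cellStep δ (absExtend v) t + cellStep δ (absExtend w) t)
      (measurable_cellStep δ _).aemeasurable
      ((measurable_cellStep δ _).add (measurable_cellStep δ _)).aemeasurable
      (Filter.Eventually.of_forall fun t => absExtend_add_le v w _)).trans
      (hσ.add_le _ _ (measurable_cellStep δ _).aemeasurable
        (measurable_cellStep δ _).aemeasurable)
  have hp_mono : ∀ {v w : Fin N → ℝ}, (∀ i, |v i| ≤ |w i|) → p v ≤ p w := fun h =>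
    ENNReal.toReal_mono (htop _) (hσ.cellStep_mono (absExtend_mono h))
  have hp_perm : ∀ (v : Fin N → ℝ) (e : Equiv.Perm (Fin N)), p (v ∘ e) = p v := fun v e => by
    simp only [hp]
    rw [absExtend_perm, hσ.rearrangement_invariant _ _ (measurable_cellStep δ _).aemeasurable
      (measurable_cellStep δ _).aemeasurable (equimeasurable_cellStep_perm hδ _ _)]
  obtain ⟨φ, hφx, hφ⟩ : ∃ φ : (Fin N → ℝ) →ₗ[ℝ] ℝ, φ x = p x ∧ ∀ v, φ v ≤ p v := by
    rcases eq_or_ne x 0 with h0 | h0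
    · refine ⟨0, ?_, fun v => ENNReal.toReal_nonneg⟩
      have := hp_smul 0 x
      rw [zero_smul, abs_zero, zero_mul] at this
      rw [h0, this]; rfl
    · obtain ⟨φ, h1, h2⟩ := exists_extension_of_le_sublinear
        (LinearPMap.mkSpanSingleton (K := ℝ) x (p x) h0) p
        (fun a ha v => by rw [hp_smul, abs_of_pos ha]) hp_add (by
          rintro ⟨v, hv⟩
          obtain ⟨a, rfl⟩ := Submodule.mem_span_singleton.1 hv
          rw [LinearPMap.mkSpanSingleton'_apply, RingHom.id_apply, smul_eq_mul]
          change a * p x ≤ p (a • x)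
          rw [hp_smul]
          exact mul_le_mul_of_nonneg_right (le_abs_self a) ENNReal.toReal_nonneg)
      refine ⟨φ, ?_, h2⟩
      have h3 := h1 ⟨x, Submodule.mem_span_singleton_self x⟩
      have h4 := LinearPMap.mkSpanSingleton_apply ℝ ℝ (σ := RingHom.id ℝ) h0 (p x)
      exact h3.trans h4
  set g₀ : Fin N → ℝ := fun i => φ (Pi.single i 1) with hg₀
  have hφ_sum : ∀ v, φ v = ∑ i, v i * g₀ i := fun v => by
    rw [LinearMap.pi_apply_eq_sum_univ φ v]
    refine Finset.sum_congr rfl fun i _ => ?_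
    simp only [hg₀, smul_eq_mul]
    congr 3
    funext j
    simp [Pi.single_apply, eq_comm]
  set s : Equiv.Perm (Fin N) := Tuple.sort fun i => -|g₀ i| with hs
  have hanti : Antitone fun i => |g₀ (s i)| := fun i j hij => by
    have := Tuple.monotone_sort (fun i => -|g₀ i|) hij
    simpa using this
  refine ⟨fun i => |g₀ (s i)|, hanti, fun i => abs_nonneg _, fun v hv => ?_, ?_⟩
  · rw [← hofp]
    refine ENNReal.ofReal_le_ofReal ?_
    calc ∑ i, |g₀ (s i)| * v i = ∑ k, |g₀ k| * v (s⁻¹ k) := by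
          rw [← Equiv.sum_comp s (fun k => |g₀ k| * v (s⁻¹ k))]; simp
      _ = φ (fun k => SignType.sign (g₀ k) * v (s⁻¹ k)) := by
          rw [hφ_sum]
          refine Finset.sum_congr rfl fun k _ => ?_
          rw [← self_mul_sign (g₀ k)]; ring
      _ ≤ p (fun k => SignType.sign (g₀ k) * v (s⁻¹ k)) := hφ _
      _ ≤ p (v ∘ (s⁻¹ : Equiv.Perm (Fin N))) := hp_mono fun k => by
          rw [abs_mul, Function.comp_apply]
          refine mul_le_of_le_one_left (abs_nonneg _) ?_
          rcases lt_trichotomy (g₀ k) 0 with h | h | h <;> simp [h]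
      _ = p v := hp_perm v _
  · rw [← hofp]
    refine ENNReal.ofReal_le_ofReal ?_
    calc p x = ∑ i, x i * g₀ i := by rw [← hφx, hφ_sum]
      _ ≤ ∑ i, |g₀ (s (s⁻¹ i))| * x i := by
          refine Finset.sum_le_sum fun i _ => ?_
          rw [mul_comm]
          simpa using mul_le_mul_of_nonneg_right (le_abs_self (g₀ i)) (hx0 i)
      _ ≤ ∑ i, |g₀ (s i)| * x i :=
          Monovary.sum_comp_perm_mul_le_sum_mul (f := fun i => |g₀ (s i)|) (σ := s⁻¹)
            (hanti.monovary hx)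

theorem cellAvg_rearr_lt_top (hσ : IsRearrangementInvariantNorm halfLine σ) (hδ : 0 < δ)
    {u : ℝ → ℝ≥0∞} (hu : AEMeasurable u halfLine) (hσu : σ u ≤ 1) (c : ℕ) :
    cellAvg δ (rearr halfLine u) c < ∞ := by
  obtain ⟨C, hC⟩ := hσ.local_embedding (Ico (c * δ) ((c + 1) * δ))
    measurableSet_Ico.nullMeasurableSet
    ((Measure.restrict_apply_le _ _).trans_lt (by simp))
  have h := hC _ (rearr_antitone (μ := halfLine) u).measurable.aemeasurable
  have hsub : Ico ((c : ℝ) * δ) ((c + 1) * δ) ⊆ Ici 0 := fun t ht =>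
    le_trans (show 0 ≤ c * δ by positivity) ht.1
  have hr : halfLine.restrict (Ico ((c : ℝ) * δ) ((c + 1) * δ)) =
      volume.restrict (Ico ((c : ℝ) * δ) ((c + 1) * δ)) := by
    rw [halfLine, Measure.restrict_congr_set Ioi_ae_eq_Ici,
      Measure.restrict_restrict measurableSet_Ico, inter_eq_left.2 hsub]
  rw [hσ.rearr_eq_norm hu, hr] at h
  refine ENNReal.mul_lt_top (by simpa using hδ) (h.trans_lt ?_)
  exact ENNReal.mul_lt_top ENNReal.coe_lt_top (hσu.trans_lt ENNReal.one_lt_top)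

/-- The associate norm of a nonincreasing step function can be tested on the cell averages of
nonincreasing functions, because averaging does not increase the norm. -/
theorem assocNorm_cellStep_le (hσ : IsRearrangementInvariantNorm halfLine σ) (hδ : 0 < δ)
    {y : ℕ → ℝ≥0∞} (hy : Antitone y) {b : ℝ≥0∞}
    (h : ∀ u, Antitone u → (∀ c, cellAvg δ u c < ∞) → σ (cellStep δ (cellAvg δ u)) ≤ 1 →
      ∑' c, y c * (ENNReal.ofReal δ * cellAvg δ u c) ≤ b) :
    assocNorm halfLine σ (cellStep δ y) ≤ b := by
  have hanti : AntitoneOn (cellStep δ y) (Ioi 0) := fun s _ t _ hst =>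
    hy (Nat.floor_mono (by gcongr))
  refine iSup_le fun u => iSup_le fun hu => iSup_le fun hu1 => ?_
  refine (lintegral_mul_le_rearr hanti hu).trans ?_
  simp only [mul_comm (rearr halfLine u _)]
  rw [lintegral_cellStep_mul hδ _ (rearr_antitone u).measurable.aemeasurable]
  refine le_of_eq_of_le (tsum_congr fun c => ?_) (h (rearr halfLine u) (rearr_antitone u)
    (hσ.cellAvg_rearr_lt_top hδ hu hu1) ?_)
  · rw [cellAvg, ← mul_assoc (ENNReal.ofReal δ), ENNReal.mul_inv_cancel (by simpa using hδ)
      ENNReal.ofReal_ne_top, one_mul]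
  · refine (hσ.cellAvg_le hδ ((rearr_antitone u).antitoneOn _)).trans ?_
    rwa [hσ.rearr_eq_norm hu]

theorem exists_dual_of_absExtend (hσ : IsRearrangementInvariantNorm halfLine σ) (hδ : 0 < δ)
    {x : Fin N → ℝ} (hx : Antitone x) (hx0 : 0 ≤ x) :
    ∃ G : ℝ → ℝ≥0∞, AntitoneOn G (Ioi 0) ∧ assocNorm halfLine σ G ≤ 1 ∧
      σ (cellStep δ (absExtend x)) ≤ ∫⁻ t, cellStep δ (absExtend x) t * G t ∂halfLine := by
  obtain ⟨g, hg, hg0, hgle, hgx⟩ := hσ.exists_antitone_functional hδ hx hx0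
  have hδ' : ENNReal.ofReal δ ≠ 0 := by simpa using hδ
  set y : ℕ → ℝ≥0∞ := fun c => (ENNReal.ofReal δ)⁻¹ * absExtend g c with hy
  have hyanti : Antitone y := fun c d hcd => by
    simp only [hy, absExtend]
    gcongr
    split_ifs with hd hc hc
    · rw [abs_of_nonneg (hg0 _), abs_of_nonneg (hg0 _)]
      exact ENNReal.ofReal_le_ofReal (hg hcd)
    · omega
    · exact zero_le
    · exact le_rfl
  -- Pairing with the step function built from `g` is pairing with the vector `g`.
  have hpair : ∀ v : Fin N → ℝ, 0 ≤ v → ∀ w : ℕ → ℝ≥0∞, (∀ i : Fin N, w i = ENNReal.ofReal (v i)) →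
      ∑' c, y c * (ENNReal.ofReal δ * w c) = ENNReal.ofReal (∑ i, g i * v i) := fun v hv w hw => by
    have h1 : ∀ c, y c * (ENNReal.ofReal δ * w c) = absExtend g c * w c := fun c => by
      simp only [hy]
      rw [mul_comm _ (absExtend g c), mul_assoc, ← mul_assoc _ _ (w c),
        ENNReal.inv_mul_cancel hδ' ENNReal.ofReal_ne_top, one_mul]
    simp only [h1]
    rw [tsum_eq_sum (s := Finset.range N) fun c hc => by
      simp [absExtend, Finset.mem_range.not.1 hc], ← Fin.sum_univ_eq_sum_range
      (fun c => absExtend g c * w c), ENNReal.ofReal_sum_of_nonneg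
      fun i _ => mul_nonneg (hg0 i) (hv i)]
    refine Finset.sum_congr rfl fun i _ => ?_
    rw [hw, ENNReal.ofReal_mul (hg0 i)]
    simp [absExtend, abs_of_nonneg (hg0 i)]
  refine ⟨cellStep δ y, fun s _ t _ hst => hyanti (Nat.floor_mono (by gcongr)),
    hσ.assocNorm_cellStep_le hδ hyanti fun u _ hfin hu1 => ?_, ?_⟩
  · rw [hpair (fun i => (cellAvg δ u i).toReal) (fun i => ENNReal.toReal_nonneg) _
      fun i => (ENNReal.ofReal_toReal (hfin i).ne).symm]
    refine (hgle _ fun i => ENNReal.toReal_nonneg).trans ((hσ.cellStep_mono fun c => ?_).trans hu1)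
    simp only [absExtend]
    split_ifs with hc
    · rw [abs_of_nonneg ENNReal.toReal_nonneg, ENNReal.ofReal_toReal (hfin c).ne]
    · exact zero_le
  · refine hgx.trans (le_of_eq ?_)
    rw [← hpair x hx0 (absExtend x) fun i => by simp [absExtend, abs_of_nonneg (hx0 i)]]
    rw [lintegral_cellStep_mul hδ _ (measurable_cellStep δ y).aemeasurable]
    refine tsum_congr fun c => ?_
    rw [setLIntegral_congr_fun (g := fun _ => y c) measurableSet_Ico fun t ht => by
      simp only [cellStep, floor_div_eq_of_mem_cell hδ ht]]
    rw [setLIntegral_const, Real.volume_Ico, show (c + 1) * δ - c * δ = δ by ring]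
    ring

/-- Lorentz–Luxemburg duality for nonincreasing right-continuous functions, with a nonincreasing
dual function. It is reduced to step functions by the Fatou property. -/
theorem exists_antitoneOn_dual (hσ : IsRearrangementInvariantNorm halfLine σ) {F : ℝ → ℝ≥0∞}
    (hF : AntitoneOn F (Ioi 0)) (hFr : ∀ t, 0 < t → ∀ a < F t, ∃ s, t < s ∧ a < F s) {b : ℝ≥0∞}
    (hb : b < σ F) :
    ∃ G : ℝ → ℝ≥0∞, AntitoneOn G (Ioi 0) ∧ assocNorm halfLine σ G ≤ 1 ∧
      b < ∫⁻ t, F t * G t ∂halfLine := by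
  have hFm : AEMeasurable F halfLine := aemeasurable_restrict_of_antitoneOn measurableSet_Ioi hF
  let d : ℕ → ℝ := fun j => (1 / 2) ^ j
  have hd : ∀ j, 0 < d j := fun j => by positivity
  have hmem : ∀ (j c : ℕ), ((c : ℝ) + 1) * d j ∈ Ioi (0 : ℝ) := fun j c =>
    mul_pos (by positivity) (hd j)
  let x : ℕ → ℕ → ℝ≥0∞ := fun j c => F ((c + 1) * d j)
  have hxF : ∀ j t, 0 < t → cellStep (d j) (x j) t ≤ F t := fun j t ht => by
    refine hF ht (hmem _ _) ?_
    rw [← div_le_iff₀ (hd j)]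
    exact (Nat.lt_floor_add_one _).le
  obtain ⟨j, hj⟩ : ∃ j, b < σ (cellStep (d j) (x j)) := by
    rw [← lt_iSup_iff, hσ.fatou _ F (fun j => (measurable_cellStep _ _).aemeasurable) hFm]
    · exact hb
    filter_upwards [ae_restrict_mem measurableSet_Ioi] with t ht
    have ht : 0 < t := ht
    refine ⟨monotone_nat_of_le_succ fun j => ?_, le_antisymm (iSup_le fun j => hxF j t ht) ?_⟩
    · simp only [cellStep, x]
      refine hF (hmem _ _) (hmem _ _) ?_
      have h1 : d (j + 1) = d j / 2 := by simp only [d, pow_succ]; ring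
      have h2 : ⌊t / d (j + 1)⌋₊ + 1 ≤ 2 * (⌊t / d j⌋₊ + 1) := by
        rw [Nat.add_one_le_iff, Nat.floor_lt (div_nonneg ht.le (hd _).le), h1]
        have := Nat.lt_floor_add_one (t / d j)
        push_cast
        calc t / (d j / 2) = 2 * (t / d j) := by field_simp
          _ < _ := by linarith
      have h3 : ((⌊t / d (j + 1)⌋₊ : ℝ) + 1) ≤ 2 * ((⌊t / d j⌋₊ : ℝ) + 1) := by exact_mod_cast h2
      calc ((⌊t / d (j + 1)⌋₊ : ℝ) + 1) * d (j + 1)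
          ≤ (2 * ((⌊t / d j⌋₊ : ℝ) + 1)) * d (j + 1) := mul_le_mul_of_nonneg_right h3 (hd _).le
        _ = ((⌊t / d j⌋₊ : ℝ) + 1) * d j := by rw [h1]; ring
    · refine le_of_forall_lt fun a ha => ?_
      obtain ⟨s, hts, has⟩ := hFr t ht a ha
      obtain ⟨j, hj⟩ := exists_pow_lt_of_lt_one (sub_pos.2 hts) (by norm_num : (1 / 2 : ℝ) < 1)
      refine lt_iSup_iff.2 ⟨j, has.trans_le (hF (hmem _ _)
        (mem_Ioi.2 (ht.trans hts)) ?_)⟩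
      have : (⌊t / d j⌋₊ : ℝ) * d j ≤ t := by
        rw [← le_div_iff₀ (hd j)]; exact Nat.floor_le (div_nonneg ht.le (hd j).le)
      have h2 : d j < s - t := hj
      linarith
  let X : (N : ℕ) → Fin N → ℝ := fun N i => (min (x j i) N).toReal
  have hX0 : ∀ N, 0 ≤ X N := fun N i => ENNReal.toReal_nonneg
  have hXe : ∀ N c, absExtend (X N) c = if c < N then min (x j c) N else 0 := fun N c => by
    simp only [absExtend]
    split_ifs with hc
    · rw [abs_of_nonneg (hX0 N _), ENNReal.ofReal_toReal]
      exact ne_top_of_le_ne_top (by simp) (min_le_right _ _)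
    · rfl
  have hXx : ∀ N, absExtend (X N) ≤ x j := fun N c => by
    rw [hXe]; split_ifs <;> simp
  obtain ⟨N, hN⟩ : ∃ N, b < σ (cellStep (d j) (absExtend (X N))) := by
    rw [← lt_iSup_iff, hσ.fatou _ (cellStep (d j) (x j))
      (fun j => (measurable_cellStep _ _).aemeasurable) (measurable_cellStep _ _).aemeasurable]
    · exact hj
    refine Filter.Eventually.of_forall fun t => ⟨fun N M hNM => ?_,
      le_antisymm (iSup_le fun N => hXx N _) ?_⟩
    · simp only [cellStep, hXe]
      split_ifs with h1 h2
      · gcongr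
      · omega
      · exact zero_le
      · exact le_rfl
    · refine le_of_forall_lt fun a ha => ?_
      obtain ⟨M, hM⟩ := ENNReal.exists_nat_gt ha.ne_top
      refine lt_iSup_iff.2 ⟨max M (⌊t / d j⌋₊ + 1), ?_⟩
      simp only [cellStep, hXe]
      rw [if_pos (by omega)]
      refine lt_min ha (hM.trans_le ?_)
      exact_mod_cast le_max_left _ _
  have hXanti : Antitone (X N) := fun c e hce => by
    refine ENNReal.toReal_mono (ne_top_of_le_ne_top (by simp) (min_le_right _ _))
      (min_le_min_right _ (hF (hmem _ _) (hmem _ _) ?_))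
    have : ((c : ℕ) : ℝ) ≤ ((e : ℕ) : ℝ) := by exact_mod_cast hce
    exact mul_le_mul_of_nonneg_right (by linarith) (hd j).le
  obtain ⟨G, hG, hG1, hle⟩ := hσ.exists_dual_of_absExtend (hd j) hXanti (hX0 N)
  refine ⟨G, hG, hG1, (hN.trans_le hle).trans_le (lintegral_mono_ae ?_)⟩
  filter_upwards [ae_restrict_mem measurableSet_Ioi] with t ht
  gcongr
  exact (_root_.cellStep_mono (hXx N) t).trans (hxF j t ht)

end IsRearrangementInvariantNorm

end Duality

/-! ### Inequalities for the Hardy operator and the supremum operator -/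

section HardyInequalities

/-- Tonelli's theorem for integrals over a relation. -/
theorem lintegral_mul_setLIntegral_swap {α β : Type*} [MeasurableSpace α] [MeasurableSpace β]
    {μ : Measure α} {ν : Measure β} [SFinite μ] [SFinite ν] {f : α → ℝ≥0∞} {g : β → ℝ≥0∞}
    (hf : AEMeasurable f μ) (hg : AEMeasurable g ν) {R : Set (α × β)} (hR : MeasurableSet R) :
    ∫⁻ x, f x * ∫⁻ y in {y | (x, y) ∈ R}, g y ∂ν ∂μ =
      ∫⁻ y, g y * ∫⁻ x in {x | (x, y) ∈ R}, f x ∂μ ∂ν := by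
  have hx : ∀ x, MeasurableSet {y | (x, y) ∈ R} := fun x => measurable_prodMk_left hR
  have hy : ∀ y, MeasurableSet {x | (x, y) ∈ R} := fun y => measurable_prodMk_right hR
  have h1 : ∀ x, f x * ∫⁻ y in {y | (x, y) ∈ R}, g y ∂ν =
      ∫⁻ y, R.indicator (fun p => f p.1 * g p.2) (x, y) ∂ν := fun x => by
    rw [← lintegral_const_mul'' _ hg.restrict, ← lintegral_indicator (hx x)]
    rfl
  have h2 : ∀ y, g y * ∫⁻ x in {x | (x, y) ∈ R}, f x ∂μ =
      ∫⁻ x, R.indicator (fun p => f p.1 * g p.2) (x, y) ∂μ := fun y => by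
    rw [← lintegral_const_mul'' _ hf.restrict, ← lintegral_indicator (hy y)]
    refine lintegral_congr fun x => ?_
    simp only [indicator, mem_ofPred_eq, mul_comm]
  simp only [h1, h2]
  exact lintegral_lintegral_swap (f := fun x y => R.indicator (fun p => f p.1 * g p.2) (x, y))
    ((hf.comp_fst.mul hg.comp_snd).indicator hR)

/-- The integral `∫_0^s G`. -/
noncomputable def headIntegral (G : ℝ → ℝ≥0∞) (s : ℝ) : ℝ≥0∞ := ∫⁻ t in Ioo 0 s, G t

/-- The least nonincreasing majorant of `s ↦ s^a G(s)`. -/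
noncomputable def decMajorant (a : ℝ) (G : ℝ → ℝ≥0∞) (t : ℝ) : ℝ≥0∞ :=
  ⨆ (s : ℝ) (_ : t ≤ s), ENNReal.ofReal (s ^ a) * G s

variable {a : ℝ} {G : ℝ → ℝ≥0∞}

theorem headIntegral_mono (G : ℝ → ℝ≥0∞) : Monotone (headIntegral G) := fun _ _ h =>
  lintegral_mono_set (Ioo_subset_Ioo_right h)

theorem decMajorant_antitone (a : ℝ) (G : ℝ → ℝ≥0∞) : Antitone (decMajorant a G) := fun _ _ h =>
  iSup_mono fun _ => iSup_mono' fun hs => ⟨h.trans hs, le_rfl⟩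

theorem le_decMajorant {s t : ℝ} (h : t ≤ s) :
    ENNReal.ofReal (s ^ a) * G s ≤ decMajorant a G t := le_iSup₂_of_le s h le_rfl

theorem supOp_eq (a : ℝ) (f : ℝ → ℝ≥0∞) (t : ℝ) :
    supOp a f t = ENNReal.ofReal (t ^ (-a)) * decMajorant a (rearr halfLine f) t := rfl

theorem supOp_antitoneOn (ha : 0 < a) (f : ℝ → ℝ≥0∞) : AntitoneOn (supOp a f) (Ioi 0) :=
  fun s hs t _ hst => by
    simp only [supOp_eq]
    gcongr ENNReal.ofReal ?_ * ?_
    · exact Real.rpow_le_rpow_of_nonpos hs hst (by linarith)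
    · exact decMajorant_antitone _ _ hst

theorem ofReal_rpow_mul_rpow {s : ℝ} (hs : 0 < s) (p q : ℝ) :
    ENNReal.ofReal (s ^ p) * ENNReal.ofReal (s ^ q) = ENNReal.ofReal (s ^ (p + q)) := by
  rw [← ENNReal.ofReal_mul (by positivity), Real.rpow_add hs]

theorem lintegral_Ioo_rpow {p : ℝ} (hp : -1 < p) {r : ℝ} (hr : 0 ≤ r) :
    ∫⁻ u in Ioo 0 r, ENNReal.ofReal (u ^ p) = ENNReal.ofReal (r ^ (p + 1) / (p + 1)) := by
  have hint := (intervalIntegral.intervalIntegrable_rpow' (a := 0) (b := r) hp)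
  rw [intervalIntegrable_iff_integrableOn_Ioo_of_le hr] at hint
  rw [← ofReal_integral_eq_lintegral_ofReal hint
    ((ae_restrict_mem measurableSet_Ioo).mono fun u hu => Real.rpow_nonneg hu.1.le _),
    ← integral_Ioc_eq_integral_Ioo, ← intervalIntegral.integral_of_le hr,
    integral_rpow (Or.inl hp), Real.zero_rpow (by linarith), sub_zero]

theorem hardyOp_antitone (a : ℝ) (h : ℝ → ℝ≥0∞) : Antitone (hardyOp a h) := fun _ _ hst =>
  lintegral_mono_set (Ioi_subset_Ioi hst)

theorem hardyOp_right_continuous (a : ℝ) (h : ℝ → ℝ≥0∞) {t : ℝ} {b : ℝ≥0∞}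
    (hb : b < hardyOp a h t) : ∃ s, t < s ∧ b < hardyOp a h s := by
  have hU : Ioi t = ⋃ n : ℕ, Ioi (t + 1 / ((n : ℝ) + 1)) := by
    ext s
    simp only [mem_Ioi, mem_iUnion]
    refine ⟨fun hs => ?_, fun ⟨n, hn⟩ => lt_trans (by
      have : 0 < 1 / ((n : ℝ) + 1) := by positivity
      linarith) hn⟩
    obtain ⟨n, hn⟩ := exists_nat_one_div_lt (sub_pos.2 hs)
    exact ⟨n, by linarith⟩
  have hmono : Monotone fun n : ℕ => Ioi (t + 1 / ((n : ℝ) + 1)) := fun i j hij =>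
    Ioi_subset_Ioi (by gcongr)
  rw [hardyOp, hU, setLIntegral_iUnion_of_directed _ hmono.directed_le] at hb
  obtain ⟨n, hn⟩ := lt_iSup_iff.1 hb
  exact ⟨_, by have : 0 < 1 / ((n : ℝ) + 1) := by positivity
               linarith, hn⟩

theorem aemeasurable_ofReal_rpow (p : ℝ) {μ : Measure ℝ} :
    AEMeasurable (fun s : ℝ => ENNReal.ofReal (s ^ p)) μ :=
  (ENNReal.measurable_ofReal.comp (measurable_id.pow_const p)).aemeasurable

/-- The Hardy operator is the transpose of `G ↦ s^{a - 1} ∫_0^s G`. -/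
theorem lintegral_mul_hardyOp (a : ℝ) {h : ℝ → ℝ≥0∞} (hG : AEMeasurable G halfLine)
    (hh : AEMeasurable h halfLine) :
    ∫⁻ t, G t * hardyOp a h t ∂halfLine =
      ∫⁻ s, h s * (ENNReal.ofReal (s ^ (a - 1)) * headIntegral G s) ∂halfLine := by
  have hR : MeasurableSet {p : ℝ × ℝ | p.1 < p.2} := measurableSet_lt measurable_fst measurable_snd
  have h1 := lintegral_mul_setLIntegral_swap hG (hh.mul (aemeasurable_ofReal_rpow (a - 1))) hR
  calc ∫⁻ t, G t * hardyOp a h t ∂halfLine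
      = ∫⁻ t, G t * ∫⁻ s in {s | (t, s) ∈ {p : ℝ × ℝ | p.1 < p.2}},
          h s * ENNReal.ofReal (s ^ (a - 1)) ∂halfLine ∂halfLine := by
        refine setLIntegral_congr_fun measurableSet_Ioi fun t ht => ?_
        have : {s | (t, s) ∈ {p : ℝ × ℝ | p.1 < p.2}} = Ioi t := rfl
        simp only [hardyOp]
        rw [this, Measure.restrict_restrict measurableSet_Ioi,
          inter_eq_left.2 (Ioi_subset_Ioi (le_of_lt ht))]
    _ = _ := h1
    _ = _ := by
        refine lintegral_congr fun s => ?_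
        have : {t | (t, s) ∈ {p : ℝ × ℝ | p.1 < p.2}} = Iio s := rfl
        rw [this, Measure.restrict_restrict measurableSet_Iio, Iio_inter_Ioi, Pi.mul_apply,
          mul_assoc]
        rfl

theorem headIntegral_two_mul_le (hG : AntitoneOn G (Ioi 0)) {r : ℝ} (hr : 0 < r) :
    headIntegral G (2 * r) ≤ 2 * headIntegral G r := by
  have h1 : ∫⁻ t in Ico r (2 * r), G t ≤ headIntegral G r :=
    calc ∫⁻ t in Ico r (2 * r), G t ≤ ∫⁻ t in Ico r (2 * r), G r :=
          setLIntegral_mono' measurableSet_Ico fun t ht => hG hr (hr.trans_le ht.1) ht.1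
      _ = ∫⁻ t in Ioo 0 r, G r := by
          rw [setLIntegral_const, setLIntegral_const, Real.volume_Ico, Real.volume_Ioo]
          congr 2; ring
      _ ≤ headIntegral G r :=
          setLIntegral_mono' measurableSet_Ioo fun t ht => hG ht.1 hr ht.2.le
  calc headIntegral G (2 * r) ≤ headIntegral G r + ∫⁻ t in Ico r (2 * r), G t := by
        rw [headIntegral, ← Ioo_union_Ico_eq_Ioo hr (by linarith : r ≤ 2 * r)]
        exact lintegral_union_le _ _ _
    _ ≤ _ := (add_le_add_right h1 _).trans_eq (two_mul _).symm

theorem self_le_rpow_mul_decMajorant {s : ℝ} (hs : 0 < s) :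
    G s ≤ ENNReal.ofReal (s ^ (-a)) * decMajorant a G s := by
  calc G s = ENNReal.ofReal (s ^ (-a)) * (ENNReal.ofReal (s ^ a) * G s) := by
        rw [← mul_assoc, ofReal_rpow_mul_rpow hs]; simp
    _ ≤ _ := by gcongr; exact le_decMajorant le_rfl

theorem decMajorant_le_headIntegral (ha : 0 < a) {s : ℝ} (hs : 0 < s) :
    decMajorant a G s ≤ ENNReal.ofReal (s ^ (a - 1)) *
      headIntegral (fun t => ENNReal.ofReal (t ^ (-a)) * decMajorant a G t) s := by
  have h1 : ENNReal.ofReal s * (ENNReal.ofReal (s ^ (-a)) * decMajorant a G s) ≤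
      headIntegral (fun t => ENNReal.ofReal (t ^ (-a)) * decMajorant a G t) s :=
    calc ENNReal.ofReal s * (ENNReal.ofReal (s ^ (-a)) * decMajorant a G s)
        = ∫⁻ t in Ioo 0 s, ENNReal.ofReal (s ^ (-a)) * decMajorant a G s := by
          rw [setLIntegral_const, Real.volume_Ioo, sub_zero, mul_comm]
      _ ≤ _ := setLIntegral_mono' measurableSet_Ioo fun t ht => by
          gcongr ENNReal.ofReal ?_ * ?_
          · exact Real.rpow_le_rpow_of_nonpos ht.1 ht.2.le (by linarith)
          · exact decMajorant_antitone _ _ ht.2.le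
  calc decMajorant a G s = ENNReal.ofReal (s ^ (a - 1)) *
        (ENNReal.ofReal s * (ENNReal.ofReal (s ^ (-a)) * decMajorant a G s)) := by
        have h2 : s ^ (a - 1) * (s * s ^ (-a)) = 1 := by
          rw [mul_left_comm, ← Real.rpow_add hs, show a - 1 + -a = -1 by ring, Real.rpow_neg_one,
            mul_inv_cancel₀ hs.ne']
        rw [← mul_assoc (ENNReal.ofReal s), ← ENNReal.ofReal_mul hs.le, ← mul_assoc,
          ← ENNReal.ofReal_mul (by positivity), h2, ENNReal.ofReal_one, one_mul]
    _ ≤ _ := by gcongr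

/-- The least nonincreasing majorant of `r^{a - 1} ∫_0^r G` is controlled by the mean of the
function `t^{-a} sup_{s ≥ t} s^a G(s)`. -/
theorem decMajorant_headIntegral_le (ha : 0 < a) (ha1 : a < 1) {s : ℝ} (hs : 0 < s) :
    decMajorant (a - 1) (headIntegral G) s ≤ ENNReal.ofReal (1 + 1 / (1 - a)) *
      (ENNReal.ofReal (s ^ (a - 1)) *
        headIntegral (fun t => ENNReal.ofReal (t ^ (-a)) * decMajorant a G t) s) := by
  set T : ℝ → ℝ≥0∞ := fun t => ENNReal.ofReal (t ^ (-a)) * decMajorant a G t with hT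
  have ha' : 0 < 1 - a := by linarith
  refine iSup₂_le fun r hr => ?_
  have hr0 : 0 < r := hs.trans_le hr
  have h1 : headIntegral G r ≤
      headIntegral T s + ENNReal.ofReal (r ^ (1 - a) / (1 - a)) * decMajorant a G s := by
    rw [headIntegral, ← Ioo_union_Ico_eq_Ioo hs hr]
    refine (lintegral_union_le _ _ _).trans (add_le_add ?_ ?_)
    · exact setLIntegral_mono' measurableSet_Ioo fun t ht => self_le_rpow_mul_decMajorant ht.1
    · calc ∫⁻ u in Ico s r, G u
          ≤ ∫⁻ u in Ico s r, ENNReal.ofReal (u ^ (-a)) * decMajorant a G s :=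
            setLIntegral_mono' measurableSet_Ico fun u hu =>
              (self_le_rpow_mul_decMajorant (hs.trans_le hu.1)).trans (by
                gcongr; exact decMajorant_antitone _ _ hu.1)
        _ ≤ ∫⁻ u in Ioo 0 r, ENNReal.ofReal (u ^ (-a)) * decMajorant a G s :=
            lintegral_mono_set fun u hu => ⟨hs.trans_le hu.1, hu.2⟩
        _ = _ := by
            rw [lintegral_mul_const'' _ (aemeasurable_ofReal_rpow _),
              lintegral_Ioo_rpow (by linarith) hr0.le, neg_add_eq_sub]
  calc ENNReal.ofReal (r ^ (a - 1)) * headIntegral G r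
      ≤ ENNReal.ofReal (r ^ (a - 1)) * (headIntegral T s +
          ENNReal.ofReal (r ^ (1 - a) / (1 - a)) * decMajorant a G s) := by gcongr
    _ = ENNReal.ofReal (r ^ (a - 1)) * headIntegral T s +
          ENNReal.ofReal (1 / (1 - a)) * decMajorant a G s := by
        rw [mul_add, ← mul_assoc (ENNReal.ofReal (r ^ (a - 1))) (ENNReal.ofReal _),
          ← ENNReal.ofReal_mul (by positivity), ← mul_div_assoc, ← Real.rpow_add hr0]
        simp
    _ ≤ ENNReal.ofReal (s ^ (a - 1)) * headIntegral T s +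
          ENNReal.ofReal (1 / (1 - a)) * (ENNReal.ofReal (s ^ (a - 1)) * headIntegral T s) := by
        gcongr ENNReal.ofReal ?_ * _ + _ * ?_
        · exact Real.rpow_le_rpow_of_nonpos hs hr (by linarith)
        · exact decMajorant_le_headIntegral ha hs
    _ = _ := by
        rw [ENNReal.ofReal_add zero_le_one (by positivity), add_mul, ENNReal.ofReal_one, one_mul]

/-- Converse to `decMajorant_headIntegral_le`. The part of the supremum over `[t, s]` is an
`L¹`-estimate; the part over `[s, ∞)` is a multiple of `t^{-a}`. -/
theorem headIntegral_le_decMajorant (ha : 0 < a) (ha1 : a < 1) (hG : Antitone G) {s : ℝ}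
    (hs : 0 < s) :
    ENNReal.ofReal (s ^ (a - 1)) *
        headIntegral (fun t => ENNReal.ofReal (t ^ (-a)) * decMajorant a G t) s ≤
      ENNReal.ofReal (5 / (1 - a)) * decMajorant (a - 1) (headIntegral G) s := by
  have ha' : 0 < 1 - a := by linarith
  set φ : ℝ → ℝ≥0∞ := fun u => ENNReal.ofReal (u ^ (a - 1)) * G u with hφ
  have hφm : ∀ μ : Measure ℝ, AEMeasurable φ μ := fun μ =>
    (aemeasurable_ofReal_rpow _).mul hG.measurable.aemeasurable
  have hloc : ∀ r, 0 < r → ENNReal.ofReal (r ^ a) * G r ≤ 2 * ∫⁻ u in Ioo (r / 2) r, φ u :=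
    fun r hr => by
    calc ENNReal.ofReal (r ^ a) * G r
        = 2 * (ENNReal.ofReal (r ^ (a - 1)) * G r * ENNReal.ofReal (r - r / 2)) := by
          have h2 : r ^ a = 2 * (r ^ (a - 1) * (r - r / 2)) := by
            rw [Real.rpow_sub_one hr.ne']; field_simp; ring
          rw [h2, ENNReal.ofReal_mul zero_le_two, ENNReal.ofReal_mul (by positivity),
            ENNReal.ofReal_ofNat]
          ring
      _ = 2 * ∫⁻ u in Ioo (r / 2) r, ENNReal.ofReal (r ^ (a - 1)) * G r := by
          rw [setLIntegral_const, Real.volume_Ioo]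
      _ ≤ _ := by
          refine mul_le_mul_right (setLIntegral_mono' measurableSet_Ioo fun u hu => ?_) _
          have hu0 : 0 < u := (half_pos hr).trans hu.1
          simp only [hφ]
          gcongr ENNReal.ofReal ?_ * ?_
          · exact Real.rpow_le_rpow_of_nonpos hu0 hu.2.le (by linarith)
          · exact hG hu.2.le
  have hsup : ∀ t ∈ Ioo 0 s, decMajorant a G t ≤
      2 * (∫⁻ u in Ioo (t / 2) s, φ u) + decMajorant a G s := fun t ht => by
    refine iSup₂_le fun r hr => ?_
    rcases le_total s r with h | h
    · exact (le_decMajorant h).trans le_add_self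
    · refine (hloc r (ht.1.trans_le hr)).trans (le_add_right ?_)
      gcongr 2 * ?_
      exact lintegral_mono_set (Ioo_subset_Ioo (by linarith) h)
  have hswap : ∫⁻ t in Ioo 0 s, ENNReal.ofReal (t ^ (-a)) * ∫⁻ u in Ioo (t / 2) s, φ u ≤
      ENNReal.ofReal (2 / (1 - a)) * headIntegral G s := by
    have hR : MeasurableSet {p : ℝ × ℝ | p.1 / 2 < p.2} :=
      measurableSet_lt (measurable_fst.div_const 2) measurable_snd
    have h := lintegral_mul_setLIntegral_swap (μ := volume.restrict (Ioo 0 s))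
      (ν := volume.restrict (Ioo 0 s)) (aemeasurable_ofReal_rpow (-a)) (hφm _) hR
    calc ∫⁻ t in Ioo 0 s, ENNReal.ofReal (t ^ (-a)) * ∫⁻ u in Ioo (t / 2) s, φ u
        = ∫⁻ t in Ioo 0 s, ENNReal.ofReal (t ^ (-a)) *
            ∫⁻ u in {u | (t, u) ∈ {p : ℝ × ℝ | p.1 / 2 < p.2}}, φ u
              ∂(volume.restrict (Ioo 0 s)) := by
          refine setLIntegral_congr_fun measurableSet_Ioo fun t ht => ?_
          have : {u | (t, u) ∈ {p : ℝ × ℝ | p.1 / 2 < p.2}} = Ioi (t / 2) := rfl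
          rw [this, Measure.restrict_restrict measurableSet_Ioi, inter_comm, Ioo_inter_Ioi,
            max_eq_right (by linarith [ht.1])]
      _ = _ := h
      _ ≤ ∫⁻ u in Ioo 0 s, ENNReal.ofReal (2 / (1 - a)) * G u := by
          refine setLIntegral_mono' measurableSet_Ioo fun u hu => ?_
          calc φ u * ∫⁻ t in {t | (t, u) ∈ {p : ℝ × ℝ | p.1 / 2 < p.2}},
                ENNReal.ofReal (t ^ (-a)) ∂(volume.restrict (Ioo 0 s))
              ≤ φ u * ∫⁻ t in Ioo 0 (2 * u), ENNReal.ofReal (t ^ (-a)) := by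
                gcongr φ u * ?_
                have hm : MeasurableSet {t | (t, u) ∈ {p : ℝ × ℝ | p.1 / 2 < p.2}} :=
                  measurable_prodMk_right hR
                rw [Measure.restrict_restrict hm]
                refine lintegral_mono_set fun t ht => ⟨ht.2.1, ?_⟩
                have : t / 2 < u := ht.1
                linarith
            _ = ENNReal.ofReal (u ^ (a - 1)) * G u *
                  ENNReal.ofReal ((2 * u) ^ (1 - a) / (1 - a)) := by
                rw [lintegral_Ioo_rpow (by linarith) (by linarith [hu.1]), neg_add_eq_sub]
            _ = ENNReal.ofReal (2 ^ (1 - a) / (1 - a)) * G u := by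
                rw [mul_right_comm, ← ENNReal.ofReal_mul (Real.rpow_nonneg hu.1.le _),
                  Real.mul_rpow zero_le_two hu.1.le]
                congr 2
                have : u ^ (a - 1) * u ^ (1 - a) = 1 := by
                  rw [← Real.rpow_add hu.1]; simp
                rw [← mul_div_assoc, mul_left_comm, this, mul_one]
            _ ≤ _ := by
                gcongr
                calc (2 : ℝ) ^ (1 - a) ≤ 2 ^ (1 : ℝ) :=
                      Real.rpow_le_rpow_of_exponent_le one_le_two (by linarith)
                  _ = 2 := Real.rpow_one 2
      _ = _ := by rw [lintegral_const_mul _ hG.measurable]; rfl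
  have hmaj : decMajorant a G s ≤ decMajorant (a - 1) (headIntegral G) s := by
    refine iSup₂_le fun r hr => le_iSup₂_of_le r hr ?_
    have hr0 : 0 < r := hs.trans_le hr
    calc ENNReal.ofReal (r ^ a) * G r
        = ENNReal.ofReal (r ^ (a - 1)) * ∫⁻ t in Ioo 0 r, G r := by
          rw [setLIntegral_const, Real.volume_Ioo, sub_zero, mul_comm (G r), ← mul_assoc,
            ← ENNReal.ofReal_mul (by positivity), Real.rpow_sub_one hr0.ne',
            div_mul_cancel₀ _ hr0.ne']
      _ ≤ _ := by
          gcongr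
          exact setLIntegral_mono' measurableSet_Ioo fun t ht => hG ht.2.le
  have hhead : headIntegral (fun t => ENNReal.ofReal (t ^ (-a)) * decMajorant a G t) s ≤
      ENNReal.ofReal (4 / (1 - a)) * headIntegral G s +
        ENNReal.ofReal (s ^ (1 - a) / (1 - a)) * decMajorant a G s := by
    calc headIntegral (fun t => ENNReal.ofReal (t ^ (-a)) * decMajorant a G t) s
        ≤ ∫⁻ t in Ioo 0 s, (2 * (ENNReal.ofReal (t ^ (-a)) * ∫⁻ u in Ioo (t / 2) s, φ u) +
            ENNReal.ofReal (t ^ (-a)) * decMajorant a G s) := by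
          refine setLIntegral_mono' measurableSet_Ioo fun t ht => ?_
          rw [mul_left_comm, ← mul_add]
          gcongr
          exact hsup t ht
      _ = 2 * (∫⁻ t in Ioo 0 s, ENNReal.ofReal (t ^ (-a)) * ∫⁻ u in Ioo (t / 2) s, φ u) +
            ENNReal.ofReal (s ^ (1 - a) / (1 - a)) * decMajorant a G s := by
          rw [lintegral_add_right' _ ((aemeasurable_ofReal_rpow _).mul_const _),
            lintegral_mul_const'' _ (aemeasurable_ofReal_rpow _),
            lintegral_Ioo_rpow (by linarith) hs.le, neg_add_eq_sub,
            lintegral_const_mul' _ _ (by simp)]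
      _ ≤ 2 * (ENNReal.ofReal (2 / (1 - a)) * headIntegral G s) +
            ENNReal.ofReal (s ^ (1 - a) / (1 - a)) * decMajorant a G s := by gcongr
      _ = _ := by
          rw [← mul_assoc, ← ENNReal.ofReal_ofNat 2, ← ENNReal.ofReal_mul zero_le_two]
          congr 3; ring
  calc ENNReal.ofReal (s ^ (a - 1)) *
        headIntegral (fun t => ENNReal.ofReal (t ^ (-a)) * decMajorant a G t) s
      ≤ ENNReal.ofReal (s ^ (a - 1)) * (ENNReal.ofReal (4 / (1 - a)) * headIntegral G s +
        ENNReal.ofReal (s ^ (1 - a) / (1 - a)) * decMajorant a G s) := by gcongr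
    _ = ENNReal.ofReal (4 / (1 - a)) * (ENNReal.ofReal (s ^ (a - 1)) * headIntegral G s) +
        ENNReal.ofReal (1 / (1 - a)) * decMajorant a G s := by
        rw [mul_add, mul_left_comm, ← mul_assoc (ENNReal.ofReal (s ^ (a - 1))) (ENNReal.ofReal _)
          (decMajorant a G s), ← ENNReal.ofReal_mul (by positivity), ← mul_div_assoc,
          ← Real.rpow_add hs]
        simp
    _ ≤ ENNReal.ofReal (4 / (1 - a)) * decMajorant (a - 1) (headIntegral G) s +
        ENNReal.ofReal (1 / (1 - a)) * decMajorant (a - 1) (headIntegral G) s := by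
        gcongr
        exact le_decMajorant le_rfl
    _ = _ := by
        rw [← add_mul, ← ENNReal.ofReal_add (by positivity) (by positivity)]
        congr 2; ring

/-- The function `r^{a - 1} ∫_0^r G` is doubling in both directions. -/
theorem rpow_mul_headIntegral_le (ha : 0 < a) (ha1 : a < 1) (hG : AntitoneOn G (Ioi 0)) {r s : ℝ}
    (hr : 0 < r) (hrs : r / 2 ≤ s) (hsr : s ≤ 2 * r) :
    ENNReal.ofReal (r ^ (a - 1)) * headIntegral G r ≤
      2 * (ENNReal.ofReal (s ^ (a - 1)) * headIntegral G s) := by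
  have hs : 0 < s := (half_pos hr).trans_le hrs
  rcases le_total s r with h | h
  · rw [mul_left_comm]
    gcongr ENNReal.ofReal ?_ * ?_
    · exact Real.rpow_le_rpow_of_nonpos hs h (by linarith)
    · exact (headIntegral_mono G (by linarith)).trans (headIntegral_two_mul_le hG hs)
  · rw [← mul_assoc, ← ENNReal.ofReal_ofNat 2, ← ENNReal.ofReal_mul zero_le_two]
    gcongr ENNReal.ofReal ?_ * ?_
    · calc r ^ (a - 1) = 2 ^ (1 - a) * (2 * r) ^ (a - 1) := by
            rw [Real.mul_rpow zero_le_two hr.le, ← mul_assoc, ← Real.rpow_add two_pos]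
            simp
        _ ≤ 2 ^ (1 : ℝ) * s ^ (a - 1) := by
            refine mul_le_mul (Real.rpow_le_rpow_of_exponent_le one_le_two (by linarith))
              (Real.rpow_le_rpow_of_nonpos hs hsr (by linarith)) (by positivity) (by positivity)
        _ = _ := by rw [Real.rpow_one]
    · exact headIntegral_mono G h

end HardyInequalities

/-! ### Approximate preimages under the Hardy operator -/

section HardyPreimage

/-- The function `∫ r(l)^{-a} χ_{(0, r(l))} dl`. If `r` is the distribution function of a
nonincreasing `q = ∫ χ_{(0, r(l))} dl`, then its image under the Hardy operator is at most a
multiple of `q` (`hardyOp_hardyPreimage_le`), and its integral against a nonincreasing function is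
at least a multiple of that of `q` (`lintegral_mul_distribution_le`). -/
noncomputable def hardyPreimage (a : ℝ) (r : ℝ → ℝ) (t : ℝ) : ℝ≥0∞ :=
  ∫⁻ l in {l | t < r l}, ENNReal.ofReal (r l ^ (-a)) ∂halfLine

variable {a : ℝ} {r : ℝ → ℝ}

theorem hardyPreimage_antitone (a : ℝ) (r : ℝ → ℝ) : Antitone (hardyPreimage a r) :=
  fun _ _ h => lintegral_mono_set fun _ hl => lt_of_le_of_lt h hl

theorem aemeasurable_ofReal_rpow_comp (hr : Measurable r) (p : ℝ) {μ : Measure ℝ} :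
    AEMeasurable (fun l => ENNReal.ofReal (r l ^ p)) μ :=
  (ENNReal.measurable_ofReal.comp (hr.pow_const p)).aemeasurable

theorem hardyOp_hardyPreimage_le (ha : 0 < a) (hr : Measurable r) {t : ℝ} (ht : 0 < t) :
    hardyOp a (hardyPreimage a r) t ≤ ENNReal.ofReal (1 / a) * halfLine {l | t < r l} := by
  have hR : MeasurableSet {p : ℝ × ℝ | p.1 < r p.2} :=
    measurableSet_lt measurable_fst (hr.comp measurable_snd)
  have h := lintegral_mul_setLIntegral_swap (μ := volume.restrict (Ioi t)) (ν := halfLine)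
    (aemeasurable_ofReal_rpow (a - 1)) (aemeasurable_ofReal_rpow_comp hr (-a)) hR
  have hm : MeasurableSet {l | t < r l} := measurableSet_lt measurable_const hr
  calc hardyOp a (hardyPreimage a r) t
      = ∫⁻ s in Ioi t, ENNReal.ofReal (s ^ (a - 1)) *
          ∫⁻ l in {l | (s, l) ∈ {p : ℝ × ℝ | p.1 < r p.2}}, ENNReal.ofReal (r l ^ (-a))
            ∂halfLine := lintegral_congr fun s => mul_comm _ _
    _ = _ := h
    _ ≤ ∫⁻ l, {l | t < r l}.indicator (fun _ => ENNReal.ofReal (1 / a)) l ∂halfLine := by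
        refine lintegral_mono fun l => ?_
        have hset : {s | (s, l) ∈ {p : ℝ × ℝ | p.1 < r p.2}} = Iio (r l) := rfl
        rw [hset, Measure.restrict_restrict measurableSet_Iio, Iio_inter_Ioi]
        by_cases hl : t < r l
        · have hl0 : 0 < r l := ht.trans hl
          rw [indicator_of_mem (show l ∈ {l | t < r l} from hl)]
          calc ENNReal.ofReal (r l ^ (-a)) * ∫⁻ s in Ioo t (r l), ENNReal.ofReal (s ^ (a - 1))
              ≤ ENNReal.ofReal (r l ^ (-a)) *
                  ∫⁻ s in Ioo 0 (r l), ENNReal.ofReal (s ^ (a - 1)) := by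
                gcongr
            _ = ENNReal.ofReal (1 / a) := by
                rw [lintegral_Ioo_rpow (by linarith) hl0.le, ← ENNReal.ofReal_mul (by positivity),
                  sub_add_cancel, ← mul_div_assoc, ← Real.rpow_add hl0]
                simp
        · rw [Ioo_eq_empty hl]
          simp
    _ = _ := by rw [lintegral_indicator hm, setLIntegral_const]

theorem headIntegral_le_of_antitoneOn (ha1 : a < 1) {T : ℝ → ℝ≥0∞}
    (hT : AntitoneOn T (Ioi 0)) {R : ℝ} (hR : 0 < R) :
    headIntegral T R ≤ 4 * (ENNReal.ofReal (R ^ (-a)) *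
      ∫⁻ s in Ioo 0 R, ENNReal.ofReal (s ^ (a - 1)) * headIntegral T s) := by
  calc headIntegral T R ≤ 2 * headIntegral T (R / 2) := by
        simpa [mul_div_cancel₀] using headIntegral_two_mul_le hT (half_pos hR)
    _ = 4 * (ENNReal.ofReal (R ^ (-a)) *
          ∫⁻ s in Ioo (R / 2) R, ENNReal.ofReal (R ^ (a - 1)) * headIntegral T (R / 2)) := by
        rw [setLIntegral_const, Real.volume_Ioo]
        have h1 : 4 * (R ^ (-a) * (R ^ (a - 1) * (R - R / 2))) = 2 := by
          rw [← mul_assoc (R ^ (-a)), ← Real.rpow_add hR]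
          have : -a + (a - 1) = -1 := by ring
          rw [this, Real.rpow_neg_one]
          field_simp
          norm_num
        have h2 : (2 : ℝ≥0∞) = 4 * (ENNReal.ofReal (R ^ (-a)) * (ENNReal.ofReal (R ^ (a - 1)) *
            ENNReal.ofReal (R - R / 2))) := by
          rw [← ENNReal.ofReal_mul (by positivity), ← ENNReal.ofReal_mul (by positivity),
            ← ENNReal.ofReal_ofNat 4, ← ENNReal.ofReal_mul (by norm_num), h1, ENNReal.ofReal_ofNat]
        rw [h2]
        ring
    _ ≤ 4 * (ENNReal.ofReal (R ^ (-a)) *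
          ∫⁻ s in Ioo (R / 2) R, ENNReal.ofReal (s ^ (a - 1)) * headIntegral T s) := by
        gcongr 4 * (_ * ?_)
        refine setLIntegral_mono' measurableSet_Ioo fun s hs => ?_
        gcongr ENNReal.ofReal ?_ * ?_
        · exact Real.rpow_le_rpow_of_nonpos ((half_pos hR).trans hs.1) hs.2.le (by linarith)
        · exact headIntegral_mono T hs.1.le
    _ ≤ _ := by
        gcongr
        linarith

/-- By `lintegral_mul_hardyOp`, the right-hand side is four times the integral of `T` against the
image of `hardyPreimage a r` under the Hardy operator. -/
theorem lintegral_mul_distribution_le (ha1 : a < 1) (hr : Measurable r) {T : ℝ → ℝ≥0∞}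
    (hT : AntitoneOn T (Ioi 0)) :
    ∫⁻ t, T t * halfLine {l | t < r l} ∂halfLine ≤
      4 * ∫⁻ s, hardyPreimage a r s * (ENNReal.ofReal (s ^ (a - 1)) * headIntegral T s)
        ∂halfLine := by
  have hTm : AEMeasurable T halfLine := aemeasurable_restrict_of_antitoneOn measurableSet_Ioi hT
  have hR : MeasurableSet {p : ℝ × ℝ | p.1 < r p.2} :=
    measurableSet_lt measurable_fst (hr.comp measurable_snd)
  have h1 := lintegral_mul_setLIntegral_swap (μ := halfLine) (ν := halfLine) hTm
    (g := fun _ => 1) aemeasurable_const hR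
  have hψ : AEMeasurable (fun s => ENNReal.ofReal (s ^ (a - 1)) * headIntegral T s) halfLine :=
    (aemeasurable_ofReal_rpow _).mul (headIntegral_mono T).measurable.aemeasurable
  have h2 := lintegral_mul_setLIntegral_swap (μ := halfLine) (ν := halfLine) hψ
    (aemeasurable_ofReal_rpow_comp hr (-a)) hR
  have hset : ∀ l, {s | (s, l) ∈ {p : ℝ × ℝ | p.1 < r p.2}} = Iio (r l) := fun l => rfl
  calc ∫⁻ t, T t * halfLine {l | t < r l} ∂halfLine
      = ∫⁻ l, headIntegral T (r l) ∂halfLine := by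
        simp only [setLIntegral_one, one_mul, hset, Measure.restrict_restrict measurableSet_Iio,
          Iio_inter_Ioi] at h1
        exact h1
    _ ≤ ∫⁻ l, 4 * (ENNReal.ofReal (r l ^ (-a)) *
          ∫⁻ s in Ioo 0 (r l), ENNReal.ofReal (s ^ (a - 1)) * headIntegral T s) ∂halfLine := by
        refine lintegral_mono fun l => ?_
        rcases le_or_gt (r l) 0 with hl | hl
        · simp [headIntegral, Ioo_eq_empty (not_lt.2 hl)]
        · exact headIntegral_le_of_antitoneOn ha1 hT hl
    _ = 4 * ∫⁻ s, hardyPreimage a r s * (ENNReal.ofReal (s ^ (a - 1)) * headIntegral T s)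
          ∂halfLine := by
        rw [lintegral_const_mul' _ _ (by simp)]
        congr 1
        simp only [hset, Measure.restrict_restrict measurableSet_Iio, Iio_inter_Ioi] at h2
        rw [← h2]
        exact lintegral_congr fun s => mul_comm _ _

end HardyPreimage

/-! ### Dyadic displacement -/

section DyadicDisplacement

/-- The integer part of the binary logarithm. -/
noncomputable def intLog (t : ℝ) : ℤ := ⌊Real.logb 2 t⌋

theorem measurable_intLog : Measurable intLog :=
  Int.measurable_floor.comp (by unfold Real.logb; fun_prop)

theorem intLog_eq_iff {t : ℝ} (ht : 0 < t) {j : ℤ} :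
    intLog t = j ↔ 2 ^ j ≤ t ∧ t < 2 ^ (j + 1) := by
  rw [intLog, Int.floor_eq_iff, Real.le_logb_iff_rpow_le one_lt_two ht,
    Real.logb_lt_iff_lt_rpow one_lt_two ht, Real.rpow_intCast]
  rw [show (j : ℝ) + 1 = ((j + 1 : ℤ) : ℝ) by push_cast; rfl, Real.rpow_intCast]

/-- The map translating each dyadic block `[2^j, 2^(j + 1))` by `2^(i j)`. If `j < i j` for all `j`
then it maps the block into `[2^(i j), 2^(i j + 1))`, and it is injective on `(0, ∞)`. -/
noncomputable def dyadicShift (i : ℤ → ℤ) (t : ℝ) : ℝ := t + 2 ^ i (intLog t)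

/-- The left inverse on `(0, ∞)` of all the maps `dyadicShift i` with `j < i j` for all `j`. -/
noncomputable def dyadicUnshift (s : ℝ) : ℝ := s - 2 ^ intLog s

variable {i : ℤ → ℤ}

theorem measurable_dyadicShift (i : ℤ → ℤ) : Measurable (dyadicShift i) :=
  measurable_id.add ((measurable_of_countable fun j : ℤ => (2 : ℝ) ^ i j).comp measurable_intLog)

theorem measurable_dyadicUnshift : Measurable dyadicUnshift :=
  measurable_id.sub ((measurable_of_countable fun j : ℤ => (2 : ℝ) ^ j).comp measurable_intLog)

theorem dyadicShift_mem (hi : ∀ j, j < i j) {t : ℝ} (ht : 0 < t) :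
    2 ^ i (intLog t) ≤ dyadicShift i t ∧ dyadicShift i t < 2 ^ (i (intLog t) + 1) := by
  have h := (intLog_eq_iff ht).1 rfl
  have h1 : (2 : ℝ) ^ (intLog t + 1) ≤ 2 ^ i (intLog t) :=
    zpow_le_zpow_right₀ one_le_two (hi _)
  rw [dyadicShift, zpow_add_one₀ two_ne_zero]
  constructor <;> linarith [h.2]

theorem dyadicUnshift_dyadicShift (hi : ∀ j, j < i j) {t : ℝ} (ht : 0 < t) :
    dyadicUnshift (dyadicShift i t) = t := by
  have h := dyadicShift_mem hi ht
  have hpos : 0 < dyadicShift i t := lt_of_lt_of_le (by positivity) h.1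
  rw [dyadicUnshift, (intLog_eq_iff hpos).2 h, dyadicShift, add_sub_cancel_right]

/-- The image of `(0, ∞)` under `dyadicShift i`, provided that `j < i j` for all `j`. -/
def dyadicShiftRange (i : ℤ → ℤ) : Set ℝ :=
  {s | 0 < dyadicUnshift s ∧ dyadicShift i (dyadicUnshift s) = s}

theorem measurableSet_dyadicShiftRange (i : ℤ → ℤ) : MeasurableSet (dyadicShiftRange i) :=
  (measurableSet_lt measurable_const measurable_dyadicUnshift).inter
    (measurableSet_eq_fun ((measurable_dyadicShift i).comp measurable_dyadicUnshift) measurable_id)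

theorem dyadicShiftRange_subset (i : ℤ → ℤ) : dyadicShiftRange i ⊆ Ioi 0 := fun s hs => by
  rw [mem_Ioi, ← hs.2, dyadicShift]
  have h : 0 < dyadicUnshift s := hs.1
  positivity

theorem measure_eq_tsum_inter_preimage {μ : Measure ℝ} {S : Set ℝ} (hS : MeasurableSet S)
    {f : ℝ → ℤ} (hf : Measurable f) : μ S = ∑' j, μ (S ∩ f ⁻¹' {j}) := by
  rw [← measure_iUnion]
  · rw [← inter_iUnion, iUnion_eq_univ_iff.2 fun x => ⟨f x, rfl⟩, inter_univ]
  · intro j l hjl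
    exact disjoint_left.2 fun x hx hx' => hjl (hx.2.symm.trans hx'.2)
  · exact fun j => hS.inter (hf (measurableSet_singleton j))

theorem map_dyadicShift (hi : ∀ j, j < i j) :
    halfLine.map (dyadicShift i) = volume.restrict (dyadicShiftRange i) := by
  ext A hA
  have hSA : MeasurableSet (dyadicShift i ⁻¹' A) := measurable_dyadicShift i hA
  rw [Measure.map_apply (measurable_dyadicShift i) hA, Measure.restrict_apply hSA,
    Measure.restrict_apply hA,
    measure_eq_tsum_inter_preimage (hSA.inter measurableSet_Ioi) measurable_intLog,
    measure_eq_tsum_inter_preimage (hA.inter (measurableSet_dyadicShiftRange i))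
      (measurable_intLog.comp measurable_dyadicUnshift)]
  refine tsum_congr fun j => ?_
  rw [← measure_preimage_add_right volume (2 ^ i j) (A ∩ _ ∩ _)]
  congr 1
  ext t
  constructor
  · rintro ⟨⟨hA, ht⟩, hj⟩
    have hj : intLog t = j := hj
    have ht : 0 < t := ht
    have hs : t + 2 ^ i j = dyadicShift i t := by rw [dyadicShift, hj]
    have hu := dyadicUnshift_dyadicShift hi ht
    change (t + 2 ^ i j ∈ A ∧ 0 < dyadicUnshift (t + 2 ^ i j) ∧
      dyadicShift i (dyadicUnshift (t + 2 ^ i j)) = t + 2 ^ i j) ∧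
      intLog (dyadicUnshift (t + 2 ^ i j)) = j
    rw [hs, hu]
    exact ⟨⟨hA, ht, rfl⟩, hj⟩
  · rintro ⟨⟨hA, h0, hs⟩, hj⟩
    have hj : intLog (dyadicUnshift (t + 2 ^ i j)) = j := hj
    have ht : dyadicUnshift (t + 2 ^ i j) = t := by
      have h := hs
      rw [dyadicShift, hj] at h
      exact add_right_cancel h
    rw [ht] at h0 hs hj
    refine ⟨⟨?_, h0⟩, hj⟩
    rwa [mem_preimage, hs]

/-- Let `w` be doubling. Moving each dyadic block of `k` to the right, to a block where `w` nearly
attains its supremum, gives a function equimeasurable with `k` whose integral against `w` dominates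
that of `k` against the least nonincreasing majorant of `w`. The truncation at `M` is needed because
the majorant may be infinite. -/
theorem exists_equimeasurable_lintegral_le {w : ℝ → ℝ≥0∞} (hw : Measurable w)
    (hdbl : ∀ r s, 0 < r → r / 2 ≤ s → s ≤ 2 * r → w r ≤ 2 * w s) {k : ℝ → ℝ≥0∞}
    (hk : Measurable k) (M : ℝ≥0) :
    ∃ h : ℝ → ℝ≥0∞, Measurable h ∧ Equimeasurable halfLine halfLine h k ∧
      ∫⁻ t, k t * min (⨆ (s : ℝ) (_ : t ≤ s), w s) M ∂halfLine ≤
        8 * ∫⁻ s, h s * w s ∂halfLine := by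
  have hex : ∀ j : ℤ, ∃ l : ℤ, j < l ∧
      min (⨆ (s : ℝ) (_ : (2 : ℝ) ^ j ≤ s), w s) M ≤ 4 * w (2 ^ l) := fun j => by
    set m := min (⨆ (s : ℝ) (_ : (2 : ℝ) ^ j ≤ s), w s) (M : ℝ≥0∞) with hm
    rcases eq_or_ne m 0 with h0 | h0
    · exact ⟨j + 1, by omega, by rw [h0]; exact zero_le⟩
    have hmtop : m ≠ ∞ := ne_top_of_le_ne_top ENNReal.coe_ne_top (min_le_right _ _)
    have hlt : m / 2 < ⨆ (s : ℝ) (_ : (2 : ℝ) ^ j ≤ s), w s :=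
      (ENNReal.half_lt_self h0 hmtop).trans_le (min_le_left _ _)
    obtain ⟨s, hs⟩ := lt_iSup_iff.1 hlt
    obtain ⟨hjs, hs⟩ := lt_iSup_iff.1 hs
    have hs0 : 0 < s := lt_of_lt_of_le (by positivity) hjs
    have hl := (intLog_eq_iff hs0).1 rfl
    refine ⟨intLog s + 1, ?_, ?_⟩
    · have : (2 : ℝ) ^ j < 2 ^ (intLog s + 1) := hjs.trans_lt hl.2
      exact (zpow_lt_zpow_iff_right₀ one_lt_two).1 this
    · have h1 : w s ≤ 2 * w (2 ^ (intLog s + 1)) := hdbl _ _ hs0 (by linarith [hl.2]) (by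
        rw [zpow_add_one₀ two_ne_zero]; linarith [hl.1])
      calc m = 2 * (m / 2) := (ENNReal.mul_div_cancel two_ne_zero ENNReal.ofNat_ne_top).symm
        _ ≤ 2 * (2 * w (2 ^ (intLog s + 1))) := by gcongr; exact hs.le.trans h1
        _ = _ := by rw [← mul_assoc]; norm_num
  choose i hi hiw using hex
  have hmeas : Measurable ((dyadicShiftRange i).indicator (k ∘ dyadicUnshift)) :=
    (hk.comp measurable_dyadicUnshift).indicator (measurableSet_dyadicShiftRange i)
  have hrestr : halfLine.restrict (dyadicShiftRange i) = halfLine.map (dyadicShift i) := by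
    rw [map_dyadicShift hi, Measure.restrict_restrict (measurableSet_dyadicShiftRange i),
      inter_eq_left.2 (dyadicShiftRange_subset i)]
  refine ⟨(dyadicShiftRange i).indicator (k ∘ dyadicUnshift), hmeas,
    equimeasurable_iff.2 fun s => ?_, ?_⟩
  · have hm : MeasurableSet {x | s < (k ∘ dyadicUnshift) x} :=
      measurableSet_lt measurable_const (hk.comp measurable_dyadicUnshift)
    have hset : {x | s < (dyadicShiftRange i).indicator (k ∘ dyadicUnshift) x} =
        {x | s < (k ∘ dyadicUnshift) x} ∩ dyadicShiftRange i := by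
      ext x
      by_cases hx : x ∈ dyadicShiftRange i <;> simp [hx]
    rw [hset, ← Measure.restrict_apply hm, hrestr, Measure.map_apply (measurable_dyadicShift i) hm,
      Measure.restrict_apply' measurableSet_Ioi, Measure.restrict_apply' measurableSet_Ioi]
    congr 1
    ext t
    simp only [mem_inter_iff, mem_preimage, mem_ofPred_eq, mem_Ioi, Function.comp_apply]
    refine and_congr_left fun ht => ?_
    rw [dyadicUnshift_dyadicShift hi ht]
  · have h1 : ∫⁻ s, (dyadicShiftRange i).indicator (k ∘ dyadicUnshift) s * w s ∂halfLine =
        ∫⁻ t, k (dyadicUnshift (dyadicShift i t)) * w (dyadicShift i t) ∂halfLine := by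
      rw [← lintegral_map (f := fun s => k (dyadicUnshift s) * w s)
        ((hk.comp measurable_dyadicUnshift).mul hw) (measurable_dyadicShift i), ← hrestr,
        ← lintegral_indicator (measurableSet_dyadicShiftRange i)]
      refine lintegral_congr fun s => ?_
      by_cases hs : s ∈ dyadicShiftRange i <;> simp [hs]
    rw [h1, ← lintegral_const_mul' _ _ (by simp)]
    refine setLIntegral_mono' measurableSet_Ioi fun t ht => ?_
    have ht : 0 < t := ht
    rw [dyadicUnshift_dyadicShift hi ht, mul_left_comm]
    gcongr
    have hmem := dyadicShift_mem hi ht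
    rw [zpow_add_one₀ two_ne_zero] at hmem
    have hp : (0 : ℝ) < 2 ^ i (intLog t) := by positivity
    calc min (⨆ (s : ℝ) (_ : t ≤ s), w s) (M : ℝ≥0∞)
        ≤ min (⨆ (s : ℝ) (_ : (2 : ℝ) ^ intLog t ≤ s), w s) M := by
          gcongr ?_ ⊓ _
          exact iSup_mono fun s => iSup_mono' fun hs =>
            ⟨((intLog_eq_iff ht).1 rfl).1.trans hs, le_rfl⟩
      _ ≤ 4 * w (2 ^ i (intLog t)) := hiw _
      _ ≤ 4 * (2 * w (dyadicShift i t)) := by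
          gcongr
          exact hdbl _ _ hp (by linarith) (by linarith)
      _ = _ := by rw [← mul_assoc]; norm_num

end DyadicDisplacement

/-! ### Boundedness of the supremum operator and rearrangements under the Hardy operator -/

section Equivalence

namespace IsRearrangementInvariantNorm

variable {σ : (ℝ → ℝ≥0∞) → ℝ≥0∞} {a : ℝ}

theorem assocNorm_rearr_le {G : ℝ → ℝ≥0∞} (hG : AntitoneOn G (Ioi 0)) :
    assocNorm halfLine σ (rearr halfLine G) ≤ assocNorm halfLine σ G :=
  assocNorm_mono <| (ae_restrict_mem measurableSet_Ioi).mono fun _ ht =>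
    rearr_le_self_of_antitoneOn hG ht

/-- If the supremum operator is bounded on the associate space then, up to a constant, among the
rearrangements of `h` the nonincreasing one has the largest image under the Hardy operator. -/
theorem hardyOp_le_of_supOp_bounded (hσ : IsRearrangementInvariantNorm halfLine σ) (ha : 0 < a)
    (ha1 : a < 1) {C : ℝ≥0}
    (hC : ∀ f : ℝ → ℝ≥0∞, AEMeasurable f halfLine →
      assocNorm halfLine σ (rearr halfLine (supOp a f)) ≤
        C * assocNorm halfLine σ (rearr halfLine f))
    {h : ℝ → ℝ≥0∞} (hh : AEMeasurable h halfLine)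
    (hfin : σ (hardyOp a (rearr halfLine h)) ≠ ∞) :
    σ (hardyOp a h) ≤
      ENNReal.ofReal (1 + 1 / (1 - a)) * C * σ (hardyOp a (rearr halfLine h)) := by
  have hm : ∀ k, AEMeasurable (hardyOp a k) halfLine := fun k =>
    (hardyOp_antitone a k).measurable.aemeasurable
  have hrm : ∀ k, AEMeasurable (rearr halfLine k) halfLine := fun k =>
    (rearr_antitone k).measurable.aemeasurable
  refine le_of_forall_lt fun b hb => ?_
  obtain ⟨G, hG, hG1, hbG⟩ := hσ.exists_antitoneOn_dual ((hardyOp_antitone a h).antitoneOn _)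
    (fun t _ c hc => hardyOp_right_continuous a h hc) hb
  have hGm : AEMeasurable G halfLine := aemeasurable_restrict_of_antitoneOn measurableSet_Ioi hG
  have hT := supOp_antitoneOn ha G
  have hTm : AEMeasurable (supOp a G) halfLine :=
    aemeasurable_restrict_of_antitoneOn measurableSet_Ioi hT
  refine hbG.trans_le ?_
  calc ∫⁻ t, hardyOp a h t * G t ∂halfLine = ∫⁻ t, G t * hardyOp a h t ∂halfLine := by
        simp only [mul_comm]
    _ ≤ ∫⁻ t, rearr halfLine G t * hardyOp a h t ∂halfLine :=
        lintegral_mul_le_rearr ((hardyOp_antitone a h).antitoneOn _) hGm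
    _ = ∫⁻ s, h s * (ENNReal.ofReal (s ^ (a - 1)) * headIntegral (rearr halfLine G) s)
          ∂halfLine := lintegral_mul_hardyOp a (hrm G) hh
    _ ≤ ∫⁻ s, h s * decMajorant (a - 1) (headIntegral (rearr halfLine G)) s ∂halfLine := by
        gcongr
        exact le_decMajorant le_rfl
    _ ≤ ∫⁻ s, rearr halfLine h s *
          decMajorant (a - 1) (headIntegral (rearr halfLine G)) s ∂halfLine :=
        lintegral_mul_le_rearr ((decMajorant_antitone _ _).antitoneOn _) hh
    _ ≤ ∫⁻ s, ENNReal.ofReal (1 + 1 / (1 - a)) * (rearr halfLine h s *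
          (ENNReal.ofReal (s ^ (a - 1)) * headIntegral (supOp a G) s)) ∂halfLine := by
        refine setLIntegral_mono' measurableSet_Ioi fun s hs => ?_
        rw [mul_left_comm]
        gcongr
        exact decMajorant_headIntegral_le ha ha1 hs
    _ = ENNReal.ofReal (1 + 1 / (1 - a)) *
          ∫⁻ t, supOp a G t * hardyOp a (rearr halfLine h) t ∂halfLine := by
        rw [lintegral_const_mul' _ _ ENNReal.ofReal_ne_top, lintegral_mul_hardyOp a hTm (hrm h)]
    _ ≤ ENNReal.ofReal (1 + 1 / (1 - a)) *
          ∫⁻ t, rearr halfLine (supOp a G) t * hardyOp a (rearr halfLine h) t ∂halfLine := by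
        gcongr _ * ?_
        exact lintegral_mul_le_rearr ((hardyOp_antitone a _).antitoneOn _) hTm
    _ ≤ ENNReal.ofReal (1 + 1 / (1 - a)) * (σ (hardyOp a (rearr halfLine h)) * (C * 1)) := by
        gcongr
        simp only [mul_comm (rearr halfLine (supOp a G) _)]
        refine (hσ.lintegral_mul_le (hm _) hfin _).trans ?_
        gcongr
        refine (hC G hGm).trans ?_
        gcongr
        exact (assocNorm_rearr_le hG).trans hG1
    _ = _ := by ring

/-- For `F` in the unit ball with bounded support there is a nonincreasing `k` whose image under the
Hardy operator has norm at most `1 / a`, but which is large enough to control `∫ F T`. -/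
theorem exists_hardyPreimage (hσ : IsRearrangementInvariantNorm halfLine σ) (ha : 0 < a)
    (ha1 : a < 1) {T : ℝ → ℝ≥0∞} (hT : AntitoneOn T (Ioi 0)) {F : ℝ → ℝ≥0∞}
    (hF : AEMeasurable F halfLine) (hF1 : σ F ≤ 1) (N : ℕ) (hFN : ∀ t, (N : ℝ) ≤ t → F t = 0) :
    ∃ k : ℝ → ℝ≥0∞, Antitone k ∧
      σ (hardyOp a (rearr halfLine k)) ≤ ENNReal.ofReal (1 / a) ∧
      ∫⁻ t, F t * T t ∂halfLine ≤
        4 * ∫⁻ s, k s * (ENNReal.ofReal (s ^ (a - 1)) * headIntegral T s) ∂halfLine := by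
  let r : ℝ → ℝ := fun l => (halfLine {t | ENNReal.ofReal l < F t}).toReal
  have hfin : ∀ l, halfLine {t | ENNReal.ofReal l < F t} ≠ ∞ := fun l => by
    rw [Measure.restrict_apply' measurableSet_Ioi]
    refine ne_top_of_le_ne_top (measure_Ioo_lt_top (μ := volume) (a := (0 : ℝ)) (b := N)).ne
      (measure_mono fun t ht => ⟨ht.2, ?_⟩)
    by_contra hN
    have h1 : ENNReal.ofReal l < F t := ht.1
    rw [hFN t (not_lt.1 hN)] at h1
    exact not_lt_zero h1
  have hr : Measurable r := by
    refine Antitone.measurable fun l l' hl => ENNReal.toReal_mono (hfin l) (measure_mono ?_)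
    exact fun t ht => lt_of_le_of_lt (ENNReal.ofReal_le_ofReal hl) ht
  have hq : ∀ t, 0 < t → halfLine {l | t < r l} = rearr halfLine F t := fun t ht => by
    rw [← halfLine_setOf_ofReal_lt (rearr halfLine F t)]
    congr 1
    ext l
    change t < r l ↔ ENNReal.ofReal l < rearr halfLine F t
    rw [lt_rearr_iff, ENNReal.ofReal_lt_iff_lt_toReal ht.le (hfin l)]
  refine ⟨hardyPreimage a r, hardyPreimage_antitone a r, ?_, ?_⟩
  · calc σ (hardyOp a (rearr halfLine (hardyPreimage a r)))
        ≤ σ (fun t => (Real.toNNReal (1 / a) : ℝ≥0) * rearr halfLine F t) := by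
          refine hσ.mono _ _ (hardyOp_antitone a _).measurable.aemeasurable
            ((rearr_antitone F).measurable.const_mul _).aemeasurable ?_
          filter_upwards [ae_restrict_mem measurableSet_Ioi] with t ht
          have ht : 0 < t := ht
          calc hardyOp a (rearr halfLine (hardyPreimage a r)) t
              ≤ hardyOp a (hardyPreimage a r) t := by
                refine setLIntegral_mono' measurableSet_Ioi fun s hs => ?_
                gcongr
                exact rearr_le_self_of_antitoneOn ((hardyPreimage_antitone a r).antitoneOn _)
                  (ht.trans hs)
            _ ≤ ENNReal.ofReal (1 / a) * halfLine {l | t < r l} :=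
                hardyOp_hardyPreimage_le ha hr ht
            _ = _ := by rw [hq t ht]; rfl
      _ = (Real.toNNReal (1 / a) : ℝ≥0) * σ F := by
          rw [hσ.smul _ _ (rearr_antitone F).measurable.aemeasurable, hσ.rearr_eq_norm hF]
      _ ≤ ENNReal.ofReal (1 / a) * 1 := by gcongr; rfl
      _ = _ := mul_one _
  · calc ∫⁻ t, F t * T t ∂halfLine ≤ ∫⁻ t, rearr halfLine F t * T t ∂halfLine :=
          lintegral_mul_le_rearr hT hF
      _ = ∫⁻ t, T t * halfLine {l | t < r l} ∂halfLine := by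
          refine setLIntegral_congr_fun measurableSet_Ioi fun t ht => ?_
          simp only [hq t ht, mul_comm]
      _ ≤ _ := lintegral_mul_distribution_le ha1 hr hT

/-- If, up to a constant, the nonincreasing rearrangement has the largest image under the Hardy
operator then the supremum operator is bounded on the associate space. -/
theorem supOp_bounded_of_hardyOp_le (hσ : IsRearrangementInvariantNorm halfLine σ) (ha : 0 < a)
    (ha1 : a < 1) {C : ℝ≥0}
    (hC : ∀ h k : ℝ → ℝ≥0∞, AEMeasurable h halfLine → AEMeasurable k halfLine →
      Equimeasurable halfLine halfLine h k →
      σ (hardyOp a h) ≤ C * σ (hardyOp a (rearr halfLine k))) (f : ℝ → ℝ≥0∞) :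
    assocNorm halfLine σ (rearr halfLine (supOp a f)) ≤
      4 * (ENNReal.ofReal (5 / (1 - a)) * (8 * (C * ENNReal.ofReal (1 / a)))) *
        assocNorm halfLine σ (rearr halfLine f) := by
  set G := rearr halfLine f with hG
  have hGa : Antitone G := rearr_antitone f
  have hT := supOp_antitoneOn ha f
  have hTm : AEMeasurable (supOp a f) halfLine :=
    aemeasurable_restrict_of_antitoneOn measurableSet_Ioi hT
  have hwm : Measurable fun s => ENNReal.ofReal (s ^ (a - 1)) * headIntegral G s :=
    (ENNReal.measurable_ofReal.comp (measurable_id.pow_const _)).mul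
      (headIntegral_mono G).measurable
  -- The estimate for the truncated majorants, to which monotone convergence applies.
  have hmajorant : ∀ k : ℝ → ℝ≥0∞, Antitone k →
      σ (hardyOp a (rearr halfLine k)) ≤ ENNReal.ofReal (1 / a) →
      ∫⁻ s, k s * decMajorant (a - 1) (headIntegral G) s ∂halfLine ≤
        8 * (C * ENNReal.ofReal (1 / a)) * assocNorm halfLine σ G := fun k hk hk1 => by
    have hsup : ∀ s, k s * decMajorant (a - 1) (headIntegral G) s =
        ⨆ M : ℕ, k s * min (decMajorant (a - 1) (headIntegral G) s) (M : ℝ≥0) := fun s => by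
      rw [← ENNReal.mul_iSup]
      congr 1
      refine le_antisymm (le_of_forall_lt fun b hb => ?_) (iSup_le fun M => min_le_left _ _)
      obtain ⟨M, hM⟩ := ENNReal.exists_nat_gt hb.ne_top
      exact lt_iSup_iff.2 ⟨M, lt_min hb (by simpa using hM)⟩
    simp only [hsup]
    rw [lintegral_iSup (f := fun (M : ℕ) s =>
        k s * min (decMajorant (a - 1) (headIntegral G) s) (M : ℝ≥0))
      (fun M => hk.measurable.mul ((decMajorant_antitone _ _).measurable.min measurable_const))
      fun M M' hM s => by
        dsimp only
        gcongr]
    refine iSup_le fun M => ?_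
    obtain ⟨h, hhm, hhk, hle⟩ := exists_equimeasurable_lintegral_le hwm
      (fun r s hr h1 h2 => rpow_mul_headIntegral_le ha ha1 (hGa.antitoneOn _) hr h1 h2)
      hk.measurable M
    have hH : σ (hardyOp a h) ≤ C * ENNReal.ofReal (1 / a) :=
      (hC h k hhm.aemeasurable hk.measurable.aemeasurable hhk).trans (by gcongr)
    refine hle.trans ?_
    rw [← lintegral_mul_hardyOp a hGa.measurable.aemeasurable hhm.aemeasurable, mul_assoc]
    gcongr
    simp only [mul_comm (G _)]
    refine (hσ.lintegral_mul_le (hardyOp_antitone a h).measurable.aemeasurable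
      (ne_top_of_le_ne_top (ENNReal.mul_ne_top ENNReal.coe_ne_top ENNReal.ofReal_ne_top) hH)
      G).trans ?_
    gcongr
  refine (assocNorm_rearr_le hT).trans
    (iSup_le fun F => iSup_le fun hF => iSup_le fun hF1 => ?_)
  have hFN : ∀ t, F t * supOp a f t = ⨆ N : ℕ, (Iio (N : ℝ)).indicator F t * supOp a f t :=
    fun t => by
    rw [← ENNReal.iSup_mul]
    congr 1
    refine le_antisymm ?_ (iSup_le fun N => indicator_le_self' (fun _ _ => zero_le) t)
    obtain ⟨N, hN⟩ := exists_nat_gt t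
    refine le_iSup_of_le N ?_
    rw [indicator_of_mem (mem_Iio.2 hN)]
  simp only [hFN]
  rw [lintegral_iSup' (f := fun (N : ℕ) t => (Iio (N : ℝ)).indicator F t * supOp a f t)
    (fun N => (hF.indicator measurableSet_Iio).mul hTm)
    (Filter.Eventually.of_forall fun t N N' hN => by
      dsimp only
      gcongr ?_ * _
      refine indicator_le_indicator_of_subset (Iio_subset_Iio (by exact_mod_cast hN))
        (fun _ => zero_le) t)]
  refine iSup_le fun N => ?_
  obtain ⟨k, hk, hk1, hle⟩ := hσ.exists_hardyPreimage ha ha1 hT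
    (hF.indicator (measurableSet_Iio (a := (N : ℝ))))
    ((hσ.mono _ _ (hF.indicator measurableSet_Iio) hF
      (Filter.Eventually.of_forall (indicator_le_self' fun _ _ => zero_le))).trans hF1) N
    fun t ht => indicator_of_notMem (by simpa using ht) _
  refine hle.trans ?_
  calc 4 * ∫⁻ s, k s * (ENNReal.ofReal (s ^ (a - 1)) * headIntegral (supOp a f) s) ∂halfLine
      ≤ 4 * ∫⁻ s, ENNReal.ofReal (5 / (1 - a)) *
          (k s * decMajorant (a - 1) (headIntegral G) s) ∂halfLine := by
        gcongr 4 * ?_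
        refine setLIntegral_mono' measurableSet_Ioi fun s hs => ?_
        rw [mul_left_comm (ENNReal.ofReal (5 / (1 - a)))]
        exact mul_le_mul_right (headIntegral_le_decMajorant ha ha1 hGa hs) _
    _ = 4 * (ENNReal.ofReal (5 / (1 - a)) *
          ∫⁻ s, k s * decMajorant (a - 1) (headIntegral G) s ∂halfLine) := by
        rw [lintegral_const_mul' _ _ ENNReal.ofReal_ne_top]
    _ ≤ 4 * (ENNReal.ofReal (5 / (1 - a)) *
          (8 * (C * ENNReal.ofReal (1 / a)) * assocNorm halfLine σ G)) := by
        gcongr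
        exact hmajorant k hk hk1
    _ = _ := by ring

end IsRearrangementInvariantNorm

end Equivalence

/-! ### The fundamental function -/

section FundamentalFunction

theorem indicator_Iio_eq_cellStep {t : ℝ} (ht : 0 < t) :
    (Iio t).indicator (1 : ℝ → ℝ≥0∞) = cellStep t fun c => if c = 0 then 1 else 0 := by
  funext s
  have h : ⌊s / t⌋₊ = 0 ↔ s ∈ Iio t := by
    rw [Nat.floor_eq_zero, div_lt_one ht, mem_Iio]
  by_cases hs : s ∈ Iio t <;> simp [cellStep, h, hs]

theorem halfLine_Iio (t : ℝ) : halfLine (Iio t) = ENNReal.ofReal t := by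
  rw [Measure.restrict_apply measurableSet_Iio, inter_comm, Ioi_inter_Iio, Real.volume_Ioo,
    sub_zero]

theorem equimeasurable_indicator_one {α β : Type*} [MeasurableSpace α] [MeasurableSpace β]
    {μ : Measure α} {ν : Measure β} {E : Set α} {F : Set β} (h : μ E = ν F) :
    Equimeasurable μ ν (E.indicator 1) (F.indicator 1) := by
  refine equimeasurable_iff.2 fun s => ?_
  rcases lt_or_ge s 1 with hs | hs
  · have hset : ∀ {γ : Type _} (A : Set γ), {x | s < A.indicator (1 : γ → ℝ≥0∞) x} = A :=
      fun A => by
      ext x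
      by_cases hx : x ∈ A <;> simp [hx, hs]
    have hset' : {x | s < F.indicator (1 : β → ℝ≥0∞) x} = F := by
      ext x
      by_cases hx : x ∈ F <;> simp [hx, hs]
    rw [hset, hset', h]
  · have hset : {x | s < E.indicator (1 : α → ℝ≥0∞) x} = ∅ := by
      ext x
      by_cases hx : x ∈ E <;> simp [hx, hs]
    have hset' : {x | s < F.indicator (1 : β → ℝ≥0∞) x} = ∅ := by
      ext x
      by_cases hx : x ∈ F <;> simp [hx, hs]
    rw [hset, hset', measure_empty, measure_empty]

namespace IsRearrangementInvariantNorm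

variable {σ : (ℝ → ℝ≥0∞) → ℝ≥0∞} {a : ℝ}

theorem indicator_Iio_lt_top (hσ : IsRearrangementInvariantNorm halfLine σ) (t : ℝ) :
    σ ((Iio t).indicator 1) < ∞ :=
  hσ.indicator_lt_top _ measurableSet_Iio.nullMeasurableSet (by
    rw [halfLine_Iio]; exact ENNReal.ofReal_lt_top)

/-- The fundamental function of the associate space at `t` is at most `t` divided by the fundamental
function of the space. -/
theorem assocNorm_indicator_Iio_le (hσ : IsRearrangementInvariantNorm halfLine σ) {t : ℝ}
    (ht : 0 < t) :
    assocNorm halfLine σ ((Iio t).indicator 1) ≤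
      ENNReal.ofReal t / σ ((Iio t).indicator 1) := by
  have hm : AEMeasurable ((Iio t).indicator (1 : ℝ → ℝ≥0∞)) halfLine :=
    (measurable_one.indicator measurableSet_Iio).aemeasurable
  nth_rewrite 1 [indicator_Iio_eq_cellStep ht]
  refine hσ.assocNorm_cellStep_le ht (fun c d hcd => ?_) fun u _ hfin hu1 => ?_
  · split_ifs with h1 h2
    · exact le_rfl
    · omega
    · exact zero_le
    · exact le_rfl
  · rw [tsum_eq_single 0 fun c hc => by simp [hc], if_pos rfl, one_mul, div_eq_mul_inv]
    gcongr
    rw [ENNReal.le_inv_iff_mul_le]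
    refine le_trans ?_ hu1
    lift cellAvg t u 0 to ℝ≥0 using (hfin 0).ne with c hc
    rw [← hσ.smul _ _ hm]
    refine hσ.mono _ _ (hm.const_mul _) (measurable_cellStep t _).aemeasurable
      (Filter.Eventually.of_forall fun s => ?_)
    by_cases hs : s ∈ Iio t
    · have h0 : ⌊s / t⌋₊ = 0 := by
        rw [Nat.floor_eq_zero, div_lt_one ht]; exact hs
      simp [hs, cellStep, h0, hc]
    · simp [hs]

theorem exists_le_rpow_div (hσ : IsRearrangementInvariantNorm halfLine σ) (ha : 0 < a) {C : ℝ≥0}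
    (hC : ∀ f : ℝ → ℝ≥0∞, AEMeasurable f halfLine →
      assocNorm halfLine σ (rearr halfLine (supOp a f)) ≤
        C * assocNorm halfLine σ (rearr halfLine f)) :
    ∃ c : ℝ≥0∞, 0 < c ∧ ∀ t : ℝ, 1 ≤ t →
      c ≤ ENNReal.ofReal (t ^ (1 - a)) / σ ((Iio t).indicator 1) := by
  set A : ℝ≥0∞ := σ ((Iio (1 / 2 : ℝ)).indicator 1) with hA
  have hAtop : A ≠ ∞ := (hσ.indicator_Iio_lt_top _).ne
  have hBtop : 2 * (A * C) ≠ ∞ :=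
    ENNReal.mul_ne_top (by simp) (ENNReal.mul_ne_top hAtop ENNReal.coe_ne_top)
  refine ⟨(2 * (A * C))⁻¹, ENNReal.inv_pos.2 hBtop, fun t ht => ?_⟩
  have ht0 : 0 < t := by linarith
  set f : ℝ → ℝ≥0∞ := (Iio t).indicator 1 with hf
  have hfm : Measurable f := measurable_one.indicator measurableSet_Iio
  have hfa : Antitone f := fun x y hxy => by
    by_cases hy : y ∈ Iio t
    · have hx : x ∈ Iio t := lt_of_le_of_lt hxy hy
      simp [hf, hx, hy]
    · simp [hf, hy]
  have hTm : AEMeasurable (supOp a f) halfLine :=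
    aemeasurable_restrict_of_antitoneOn measurableSet_Ioi (supOp_antitoneOn ha f)
  have hrearr : 1 ≤ rearr halfLine f (t / 2) := by
    refine le_of_forall_lt fun b hb => lt_rearr_iff.2 ?_
    have hset : {x | b < f x} = Iio t := by
      ext x
      by_cases hx : x ∈ Iio t <;> simp [hf, hx, hb]
    rw [hset, halfLine_Iio]
    exact (ENNReal.ofReal_lt_ofReal_iff ht0).2 (by linarith)
  -- On `(0, 1 / 2)` the value at `s = t / 2` already makes the supremum at least `t ^ a`.
  have hlow : ∀ s ∈ Ioo (0 : ℝ) (1 / 2), ENNReal.ofReal (t ^ a) ≤ supOp a f s := fun s hs => by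
    rw [supOp_eq]
    calc ENNReal.ofReal (t ^ a)
        ≤ ENNReal.ofReal (s ^ (-a)) * (ENNReal.ofReal ((t / 2) ^ a) * 1) := by
          rw [mul_one, ← ENNReal.ofReal_mul (Real.rpow_nonneg hs.1.le _)]
          refine ENNReal.ofReal_le_ofReal ?_
          calc t ^ a = (1 / 2) ^ (-a) * (t / 2) ^ a := by
                rw [Real.div_rpow ht0.le zero_le_two, one_div, Real.inv_rpow zero_le_two,
                  Real.rpow_neg zero_le_two, inv_inv]
                field_simp
            _ ≤ s ^ (-a) * (t / 2) ^ a := by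
                gcongr ?_ * _
                exact Real.rpow_le_rpow_of_nonpos hs.1 hs.2.le (by linarith)
      _ ≤ ENNReal.ofReal (s ^ (-a)) * decMajorant a (rearr halfLine f) s := by
          gcongr
          refine le_trans ?_ (le_decMajorant (s := t / 2) (by linarith [hs.2]))
          gcongr
  have hchi : AntitoneOn ((Iio (1 / 2 : ℝ)).indicator (1 : ℝ → ℝ≥0∞)) (Ioi 0) :=
    fun x _ y _ hxy => by
    by_cases hy : y ∈ Iio (1 / 2 : ℝ)
    · have hx : x ∈ Iio (1 / 2 : ℝ) := lt_of_le_of_lt hxy hy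
      simp only [indicator_of_mem hx, indicator_of_mem hy, Pi.one_apply, le_refl]
    · simp only [indicator_of_notMem hy, zero_le]
  have hkey : ENNReal.ofReal (t ^ a) * 2⁻¹ ≤ A * (C * (ENNReal.ofReal t / σ f)) :=
    calc ENNReal.ofReal (t ^ a) * 2⁻¹
        = ∫⁻ s in Ioo (0 : ℝ) (1 / 2), ENNReal.ofReal (t ^ a) := by
          rw [setLIntegral_const, Real.volume_Ioo, sub_zero, one_div,
            ENNReal.ofReal_inv_of_pos two_pos, ENNReal.ofReal_ofNat]
      _ ≤ ∫⁻ s in Ioo (0 : ℝ) (1 / 2), supOp a f s := setLIntegral_mono' measurableSet_Ioo hlow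
      _ = ∫⁻ s, supOp a f s * (Iio (1 / 2 : ℝ)).indicator 1 s ∂halfLine := by
          have hmul : ∀ s, supOp a f s * (Iio (1 / 2 : ℝ)).indicator 1 s =
              (Iio (1 / 2 : ℝ)).indicator (supOp a f) s := fun s => by
            by_cases hs : s ∈ Iio (1 / 2 : ℝ)
            · simp only [indicator_of_mem hs, Pi.one_apply, mul_one]
            · simp only [indicator_of_notMem hs, mul_zero]
          simp only [hmul]
          rw [lintegral_indicator measurableSet_Iio, Measure.restrict_restrict measurableSet_Iio,
            Iio_inter_Ioi]
      _ ≤ ∫⁻ s, rearr halfLine (supOp a f) s * (Iio (1 / 2 : ℝ)).indicator 1 s ∂halfLine :=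
          lintegral_mul_le_rearr hchi hTm
      _ ≤ A * assocNorm halfLine σ (rearr halfLine (supOp a f)) := by
          simp only [mul_comm (rearr halfLine (supOp a f) _)]
          exact hσ.lintegral_mul_le (measurable_one.indicator measurableSet_Iio).aemeasurable
            hAtop _
      _ ≤ A * (C * (ENNReal.ofReal t / σ f)) := by
          gcongr
          refine (hC f hfm.aemeasurable).trans ?_
          gcongr
          exact (assocNorm_rearr_le (hfa.antitoneOn _)).trans (hσ.assocNorm_indicator_Iio_le ht0)
  have hle : 1 ≤ 2 * (A * C) * (ENNReal.ofReal (t ^ (1 - a)) / σ f) := by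
    have hone : 2 * (ENNReal.ofReal (t ^ (-a)) * (ENNReal.ofReal (t ^ a) * 2⁻¹)) = 1 := by
      rw [← mul_assoc (ENNReal.ofReal _), ofReal_rpow_mul_rpow ht0, neg_add_cancel, Real.rpow_zero,
        ENNReal.ofReal_one, one_mul, ENNReal.mul_inv_cancel two_ne_zero ENNReal.ofNat_ne_top]
    calc 1 = 2 * (ENNReal.ofReal (t ^ (-a)) * (ENNReal.ofReal (t ^ a) * 2⁻¹)) := hone.symm
      _ ≤ 2 * (ENNReal.ofReal (t ^ (-a)) * (A * (C * (ENNReal.ofReal t / σ f)))) := by gcongr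
      _ = 2 * (A * C) * (ENNReal.ofReal (t ^ (1 - a)) / σ f) := by
          have h2 : ENNReal.ofReal (t ^ (1 - a)) =
              ENNReal.ofReal (t ^ (-a)) * ENNReal.ofReal t := by
            rw [← ENNReal.ofReal_mul (by positivity), sub_eq_neg_add, Real.rpow_add_one ht0.ne']
          rw [h2, div_eq_mul_inv, div_eq_mul_inv]
          ring
  have hB0 : 2 * (A * C) ≠ 0 := fun h => by
    rw [h, zero_mul] at hle
    exact one_ne_zero (le_antisymm hle zero_le)
  calc (2 * (A * C))⁻¹ ≤ (2 * (A * C))⁻¹ *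
        (2 * (A * C) * (ENNReal.ofReal (t ^ (1 - a)) / σ f)) := le_mul_of_one_le_right' hle
    _ = _ := by rw [← mul_assoc, ENNReal.inv_mul_cancel hB0 hBtop, one_mul]

end IsRearrangementInvariantNorm

end FundamentalFunction

/-! ### Equivalence of the two functionals -/

section Main

variable {n m : ℕ} {ρ : (EuclideanSpace ℝ (Fin n) → ℝ≥0∞) → ℝ≥0∞}

theorem reprNorm_hardyOp (hn : 0 < n) (hρ : IsRearrangementInvariantNorm volume ρ) (a : ℝ)
    (h : ℝ → ℝ≥0∞) : reprNorm ρ (hardyOp a h) = ρ (hardyOp a h ∘ ballVolume) :=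
  reprNorm_eq_comp_ballVolume hn hρ (hardyOp_antitone a h).measurable.aemeasurable

theorem fundamentalFunction_le (hn : 0 < n) (hρ : IsRearrangementInvariantNorm volume ρ) (t : ℝ) :
    fundamentalFunction volume ρ t ≤ ρ ((Iio t).indicator 1 ∘ ballVolume) := by
  have hV := measurePreserving_ballVolume hn
  have hm : AEMeasurable ((Iio t).indicator (1 : ℝ → ℝ≥0∞)) halfLine :=
    (measurable_one.indicator measurableSet_Iio).aemeasurable
  refine iSup_le fun E => iSup_le fun hE => iSup_le fun hEt => le_of_eq ?_
  exact hρ.rearrangement_invariant _ _ (measurable_one.indicator hE).aemeasurable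
    (hm.comp_quasiMeasurePreserving hV.quasiMeasurePreserving)
    ((equimeasurable_indicator_one (by rw [hEt, halfLine_Iio])).trans
      (hV.equimeasurable_comp hm).symm)

theorem starNorm_le_tauNorm (f : EuclideanSpace ℝ (Fin n) → ℝ≥0∞) :
    starNorm m ρ f ≤ tauNorm m ρ f :=
  le_iSup₂_of_le (rearr volume f) (rearr_antitone f).measurable.aemeasurable
    (le_iSup_of_le (equimeasurable_rearr f) le_rfl)

end Main

theorem theorem3p6 (n m : ℕ) (hm : 1 ≤ m) (hmn : m < n)
    (ρ : (EuclideanSpace ℝ (Fin n) → ℝ≥0∞) → ℝ≥0∞)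
    (hρ : IsRearrangementInvariantNorm volume ρ) :
    (BoundedOn (reprNorm (assocNorm volume ρ)) (supOp ((m : ℝ) / n)) →
      (0 < ⨅ (t : ℝ) (_ : 1 ≤ t),
        ENNReal.ofReal (t ^ (1 - (m : ℝ) / n)) / fundamentalFunction volume ρ t) ∧
      EquivalentFunctionals volume (tauNorm m ρ) (starNorm m ρ)) ∧
    (¬ BoundedOn (reprNorm (assocNorm volume ρ)) (supOp ((m : ℝ) / n)) →
      ¬ EquivalentFunctionals volume (tauNorm m ρ) (starNorm m ρ)) := by
  have hn : 0 < n := by omega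
  have hV := measurePreserving_ballVolume hn
  have hσ := hρ.comp hV
  have ha : 0 < (m : ℝ) / n := div_pos (by exact_mod_cast hm) (by exact_mod_cast hn)
  have ha1 : (m : ℝ) / n < 1 := (div_lt_one (by exact_mod_cast hn)).2 (by exact_mod_cast hmn)
  refine ⟨fun ⟨C, hC⟩ => ?_, fun hunbdd ⟨C, _, hC⟩ => hunbdd ?_⟩
  · simp only [reprNorm_assocNorm hn hρ] at hC
    constructor
    · obtain ⟨c, hc, hle⟩ := hσ.exists_le_rpow_div ha hC
      refine hc.trans_le (le_iInf₂ fun t ht => (hle t ht).trans ?_)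
      gcongr
      exact fundamentalFunction_le hn hρ t
    -- The summand `1` makes `K` positive, and at least `1` for the trivial inequality.
    · set K : ℝ≥0 := Real.toNNReal (1 + 1 / (1 - (m : ℝ) / n)) * C + 1 with hK
      refine ⟨K, by positivity, fun f hf => ⟨?_, ?_⟩⟩
      · refine iSup_le fun h => iSup_le fun hh => iSup_le fun hhf => ?_
        rw [starNorm, ← hhf.rearr_eq, reprNorm_hardyOp hn hρ, reprNorm_hardyOp hn hρ]
        by_cases hfin : ρ (hardyOp ((m : ℝ) / n) (rearr halfLine h) ∘ ballVolume) = ∞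
        · rw [hfin, ENNReal.mul_top (by simp [hK])]
          exact le_top
        · refine (hσ.hardyOp_le_of_supOp_bounded ha ha1 hC hh hfin).trans ?_
          gcongr
          rw [hK, ENNReal.coe_add, ENNReal.coe_mul]
          exact le_self_add
      · refine (starNorm_le_tauNorm f).trans (le_mul_of_one_le_left' ?_)
        rw [hK, ENNReal.coe_add, ENNReal.coe_one]
        exact le_add_self
  · have hcomp : ∀ h k : ℝ → ℝ≥0∞, AEMeasurable h halfLine → AEMeasurable k halfLine →
        Equimeasurable halfLine halfLine h k →
        ρ (hardyOp ((m : ℝ) / n) h ∘ ballVolume) ≤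
          C * ρ (hardyOp ((m : ℝ) / n) (rearr halfLine k) ∘ ballVolume) := fun h k hh hk hhk => by
      have hkV := hV.equimeasurable_comp hk
      have h1 := (hC (k ∘ ballVolume)
        (hk.comp_quasiMeasurePreserving hV.quasiMeasurePreserving)).1
      rw [starNorm, hkV.rearr_eq, reprNorm_hardyOp hn hρ] at h1
      rw [← reprNorm_hardyOp hn hρ]
      exact le_trans (le_iSup₂_of_le h hh
        (le_iSup (fun _ : Equimeasurable halfLine volume h (k ∘ ballVolume) =>
          reprNorm ρ (hardyOp ((m : ℝ) / n) h)) (hhk.trans hkV.symm))) h1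
    have h := hσ.supOp_bounded_of_hardyOp_le ha ha1 hcomp
    refine ⟨4 * (Real.toNNReal (5 / (1 - (m : ℝ) / n)) *
      (8 * (C * Real.toNNReal (1 / ((m : ℝ) / n))))), fun f _ => ?_⟩
    simp only [reprNorm_assocNorm hn hρ]
    push_cast
    exact h f
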